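/- Let $\mathrm{GF}(q)$ be a finite field with $q \neq 2$, and let $D, N$ be integers with $N > 2D \geq 6$. Let $\Gamma$ be the bilinear forms graph $H_q(D,N-D)$: its vertex set $X$ is the set of all $D\times(N-D)$ matrices over $\mathrm{GF}(q)$, and two vertices are adjacent whenever their difference has rank one. Let $\partial$ denote the path-length distance of $\Gamma$, and put $\Gamma_i(x)=\{z\in X : \partial(x,z)=i\}$ and $\Gamma(x)=\Gamma_1(x)$. Let $V=\mathbb R^X$ with the inner product $\langle u,v\rangle=u^tv$; for $x\in X$ let $\hat x\in V$ be the unit vector at $x$, and for $\Omega\subseteq X$ put $\widehat\Omega=\sum_{z\in\Omega}\hat z$. Let $\theta_0>\theta_1>\cdots>\theta_D$ be the distinct eigenvalues of the adjacency matrix of $\Gamma$, and let $E\in\mathrm{Mat}_X(\mathbb R)$ be the primitive idempotent associated with $\theta_1$, that is, the matrix that acts as the identity on the $\theta_1$-eigenspace and as $0$ on every other eigenspace. For $0\le i\le D$ let $\theta^*_i=|X|\,E_{u,v}$, where $u,v\in X$ are at distance $i$ (this does not depend on the choice of $u,v$). Fix $x,y\in X$ with $k=\partial(x,y)$ and $2\le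 k\le D-1$. Let $O_1,\dots,O_6$ be the following subsets of $\Gamma(x)$: $O_1=\Gamma(x)\cap\Gamma_{k-1}(y)$, $O_6=\Gamma(x)\cap\Gamma_{k+1}(y)$, and for $2\le i\le 5$, $O_i$ is the set of all $z\in\Gamma(x)\cap\Gamma_k(y)$ such that the pair $$\bigl(|\Gamma(x)\cap\Gamma(z)\cap\Gamma_{k-1}(y)|,\ |\Gamma(x)\cap\Gamma(z)\cap\Gamma_{k+1}(y)|\bigr)$$ equals $(2q^{k-1},0)$ for $i=2$, $(2q^{k-1}-1,0)$ for $i=3$, $(q^{k-1},q^D-q^k)$ for $i=4$, and $(q^{k-1},q^{N-D}-q^k)$ for $i=5$. For $1\le i\le 6$ define $$\lambda_i=|O_i|\,\frac{\theta^*_1-\theta^*_{k+\varepsilon(i)}}{\theta^*_0-\theta^*_k},\qquad \varepsilon(1)=-1,\quad \varepsilon(2)=\varepsilon(3)=\varepsilon(4)=\varepsilon(5)=0,\quad \varepsilon(6)=1,$$ and $O_i^\vee=\widehat O_i-\lambda_i\hat x$. Define the subspaces $$S=\mathrm{Span}\{E\widehat O_i : 1\le i\le 6\},\qquad \mathrm{Sym}(S)=\mathrm{Span}\{EO_i^\vee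 : 1\le i\le 6\},\qquad \mathrm{ASym}(S)=\mathrm{Span}\{E\hat x-E\hat y\}.$$ Then $S=\mathrm{Sym}(S)+\mathrm{ASym}(S)$, and this sum is an orthogonal direct sum. Moreover, $\dim\mathrm{Sym}(S)=5$ and $\dim\mathrm{ASym}(S)=1$. -/

import Mathlib

noncomputable section

namespace BilinearForms

/-! ### Graphs: adjacency matrix, ordered eigenvalues, primitive idempotents -/

section Graph

variable {X : Type*} [Fintype X] [DecidableEq X]

/-- The adjacency matrix of a graph with vertex set `X`, with real entries. -/
def adjacency (G : SimpleGraph X) : Matrix X X ℝ :=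
  letI := Classical.decRel G.Adj
  G.adjMatrix ℝ

/-- The eigenvalues of the graph `G`, that is, of its adjacency matrix. -/
def eigenvalueSet (G : SimpleGraph X) : Set ℝ :=
  {μ | Module.End.HasEigenvalue (Matrix.toEuclideanLin (adjacency G)) μ}

/-- The distinct eigenvalues `θ₀ > θ₁ > θ₂ > ⋯` of `G` in decreasing order. The sets below are
finite, so `sSup` is the maximum as long as there are eigenvalues left. -/
def eigenvalue (G : SimpleGraph X) : ℕ → ℝ
  | 0 => sSup (eigenvalueSet G)
  | i + 1 => sSup {μ | μ ∈ eigenvalueSet G ∧ μ < eigenvalue G i}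

/-- The primitive idempotent of `G` associated with `θ`: the matrix that acts as the identity on the
`θ`-eigenspace of the adjacency matrix, and as `0` on every other eigenspace (see the two lemmas
below). As the adjacency matrix is symmetric, it is the matrix of the orthogonal projection onto
the `θ`-eigenspace. -/
def primitiveIdempotent (G : SimpleGraph X) (θ : ℝ) : Matrix X X ℝ :=
  Matrix.toEuclideanLin.symm
    ((Module.End.eigenspace (Matrix.toEuclideanLin (adjacency G)) θ).starProjection :
      EuclideanSpace ℝ X →L[ℝ] EuclideanSpace ℝ X).toLinearMap

lemma adjacency_isHermitian {Y : Type*} (G : SimpleGraph Y) : (adjacency G).IsHermitian := by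
  let _ := Classical.decRel G.Adj
  change (G.adjMatrix ℝ).IsHermitian
  rw [Matrix.IsHermitian, Matrix.conjTranspose_eq_transpose_of_trivial]
  exact G.transpose_adjMatrix

lemma primitiveIdempotent_apply_self (G : SimpleGraph X) (θ : ℝ) (v : EuclideanSpace ℝ X)
    (hv : v ∈ Module.End.eigenspace (Matrix.toEuclideanLin (adjacency G)) θ) :
    Matrix.toEuclideanLin (primitiveIdempotent G θ) v = v := by
  rw [primitiveIdempotent, LinearEquiv.apply_symm_apply]
  exact Submodule.starProjection_eq_self_iff.mpr hv

lemma primitiveIdempotent_apply_of_ne (G : SimpleGraph X) (θ μ : ℝ) (h : μ ≠ θ)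
    (v : EuclideanSpace ℝ X)
    (hv : v ∈ Module.End.eigenspace (Matrix.toEuclideanLin (adjacency G)) μ) :
    Matrix.toEuclideanLin (primitiveIdempotent G θ) v = 0 := by
  rw [primitiveIdempotent, LinearEquiv.apply_symm_apply]
  refine (Submodule.starProjection_apply_eq_zero_iff _).mpr ?_
  have hs : (Matrix.toEuclideanLin (adjacency G)).IsSymmetric :=
    Matrix.isSymmetric_toEuclideanLin_iff.mpr (adjacency_isHermitian G)
  rw [Submodule.mem_orthogonal]
  intro u hu
  exact hs.orthogonalFamily_eigenspaces (i := θ) (j := μ) (Ne.symm h) ⟨u, hu⟩ ⟨v, hv⟩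

/-- The vertices at distance `i` from `x`. -/
def sphere (G : SimpleGraph X) (i : ℕ) (x : X) : Finset X :=
  Finset.univ.filter fun y => G.dist x y = i

open Classical in
/-- The dual eigenvalue `θ*ᵢ` with respect to `E`: the scalar `|X| E_{u,v}`, where `u, v` are
vertices at distance `i`. (When `G` is distance-regular and `E` is a primitive idempotent of `G`,
this does not depend on the pair `u, v`.) -/
def dualEigenvalue (G : SimpleGraph X) (E : Matrix X X ℝ) (i : ℕ) : ℝ :=
  if h : ∃ p : X × X, G.dist p.1 p.2 = i then
    (Fintype.card X : ℝ) * E h.choose.1 h.choose.2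
  else 0

/-- The characteristic vector of a set of vertices, the sum of the unit vectors of its elements. -/
def charVec (Ω : Finset X) : EuclideanSpace ℝ X :=
  ∑ z ∈ Ω, EuclideanSpace.single z (1 : ℝ)

end Graph

/-! ### The bilinear forms graph -/

variable (F : Type*) [Field F] [Fintype F] [DecidableEq F] (D N : ℕ)

/-- The vertices of the bilinear forms graph: the `D × (N - D)` matrices over `F`. -/
abbrev Vertex : Type _ := Matrix (Fin D) (Fin (N - D)) F

/-- The bilinear forms graph: two matrices are adjacent when their difference has rank one. -/
def graph : SimpleGraph (Vertex F D N) where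
  Adj x y := (x - y).rank = 1
  symm := ⟨fun x y h => by
    have h' : y - x = (-1 : F) • (x - y) := by simp
    rw [h', Matrix.rank_smul_of_mem_nonZeroDivisors _ (by simp)]
    exact h⟩
  loopless := ⟨fun x h => by simp at h⟩

/-- The primitive idempotent `E` associated with the second largest eigenvalue `θ₁`. -/
def idem : Matrix (Vertex F D N) (Vertex F D N) ℝ :=
  primitiveIdempotent (graph F D N) (eigenvalue (graph F D N) 1)

/-- The action of `E` on the standard module. -/
def idemMap : EuclideanSpace ℝ (Vertex F D N) →ₗ[ℝ] EuclideanSpace ℝ (Vertex F D N) :=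
  Matrix.toEuclideanLin (idem F D N)

variable {F D N}

/-- The number of common neighbours of `x` and `z` that are at distance `ℓ` from `y`. -/
def localCount (x y z : Vertex F D N) (ℓ : ℕ) : ℕ :=
  (sphere (graph F D N) 1 x ∩ sphere (graph F D N) 1 z ∩ sphere (graph F D N) ℓ y).card

/-- The vertices `z` adjacent to `x` and at the same distance `k` from `y` as `x` such that,
among the common neighbours of `x` and `z`, exactly `m` are at distance `k - 1` from `y` and
exactly `n` are at distance `k + 1` from `y`. -/
def middlePart (x y : Vertex F D N) (m n : ℕ) : Finset (Vertex F D N) :=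
  (sphere (graph F D N) 1 x ∩ sphere (graph F D N) ((graph F D N).dist x y) y).filter fun z =>
    localCount x y z ((graph F D N).dist x y - 1) = m ∧
      localCount x y z ((graph F D N).dist x y + 1) = n

/-- The `y`-partition `O₁, …, O₆` of the neighbourhood of `x` (indexed from `0`), where
`k = ∂(x, y)` and `q = |F|`. It is used for `2 ≤ k ≤ D - 1` and `2 D < N`, where none of the
subtractions truncates. -/
def part (x y : Vertex F D N) : Fin 6 → Finset (Vertex F D N) :=
  let q := Fintype.card F
  let k := (graph F D N).dist x y
  ![sphere (graph F D N) 1 x ∩ sphere (graph F D N) (k - 1) y,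
    middlePart x y (2 * q ^ (k - 1)) 0,
    middlePart x y (2 * q ^ (k - 1) - 1) 0,
    middlePart x y (q ^ (k - 1)) (q ^ D - q ^ k),
    middlePart x y (q ^ (k - 1)) (q ^ (N - D) - q ^ k),
    sphere (graph F D N) 1 x ∩ sphere (graph F D N) (k + 1) y]

/-- The distance from `y` to the vertices of `Oᵢ`. -/
def partDist (x y : Vertex F D N) : Fin 6 → ℕ :=
  let k := (graph F D N).dist x y
  ![k - 1, k, k, k, k, k + 1]

/-- The scalars `λᵢ = |Oᵢ| (θ*₁ - θ*_{d(i)}) / (θ*₀ - θ*_k)`, where `d(i)` is the distance from `y`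
to the vertices of `Oᵢ` and `k = ∂(x, y)`. -/
def lam (x y : Vertex F D N) (i : Fin 6) : ℝ :=
  let θs : ℕ → ℝ := dualEigenvalue (graph F D N) (idem F D N)
  ((part x y i).card : ℝ) * (θs 1 - θs (partDist x y i)) /
    (θs 0 - θs ((graph F D N).dist x y))

/-- The vector `Oᵢ^∨ = Ôᵢ - λᵢ x̂`. -/
def checkVec (x y : Vertex F D N) (i : Fin 6) : EuclideanSpace ℝ (Vertex F D N) :=
  charVec (part x y i) - lam x y i • EuclideanSpace.single x (1 : ℝ)

/-- The subspace `S = S(x, y)`, spanned by the vectors `E Ôᵢ`. -/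
def S (x y : Vertex F D N) : Submodule ℝ (EuclideanSpace ℝ (Vertex F D N)) :=
  Submodule.span ℝ (Set.range fun i : Fin 6 => idemMap F D N (charVec (part x y i)))

/-- The symmetric part of `S`, spanned by the vectors `E Oᵢ^∨`. -/
def symPart (x y : Vertex F D N) : Submodule ℝ (EuclideanSpace ℝ (Vertex F D N)) :=
  Submodule.span ℝ (Set.range fun i : Fin 6 => idemMap F D N (checkVec x y i))

/-- The antisymmetric part of `S`, spanned by `E x̂ - E ŷ`. -/
def asymPart (x y : Vertex F D N) : Submodule ℝ (EuclideanSpace ℝ (Vertex F D N)) :=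
  Submodule.span ℝ {idemMap F D N (EuclideanSpace.single x (1 : ℝ)) -
    idemMap F D N (EuclideanSpace.single y (1 : ℝ))}

end BilinearForms

end

set_option linter.unusedSectionVars false

/-! The graph is a Cayley graph on the additive group of matrices, so it is diagonalised by the
characters `z ↦ χ(∑ Aᵢⱼ zᵢⱼ)`, and the eigenvalue at `A` depends only on the rank of `A`
(`sum_rank_one_chi`). Since the pairing is symmetric, the same function `theta` gives the dual
eigenvalues, and `E` is the sum of the character projections over the rank one `A`. Hence `E v = 0`
exactly when the Fourier transform of `v` vanishes at every `abᵀ` with `a, b ≠ 0`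
(`idemMap_eq_zero_iff`), and every linear relation in `S` becomes an identity between character sums
over the `Oᵢ`.

Write `B = x - y = GH` with `G` of full column rank and `H` of full row rank. A neighbour `x + uvᵀ`
is classified by whether `u` lies in the column space of `B`, whether `v` lies in the row space and,
if both hold with `u = Gu'` and `v = v'H`, whether `v' ⬝ u'` is `-1`, `0` or something else. The
local counts defining the `Oᵢ` recover exactly these six classes (`mem_part_iff`), so the character
sums can be evaluated. Those over `O₁` and `O₂` involve `s = aᵀBb`, through `χ(-s)` and the
indicator of `s = 0`; suitable unions of parts give rank one sums of smaller bilinear forms.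

Varying `s`, and then letting `aᵀG` and `Hb` vanish or not, forces all coefficients of a relation to
be zero (`eq_zero_of_sum_mul_partSum`), so `dim S = 6`. The same formulas put `E x̂` and `E ŷ` in
`S`. The `λᵢ` are chosen to make `E Oᵢ^∨` orthogonal to `E x̂ - E ŷ ≠ 0`. As `S` lies in `Sym(S)`
plus the line of `E x̂`, counting dimensions leaves only `5 + 1 = 6`. -/

namespace BilinearForms

open Matrix

/-! ### Rank one perturbations and rank factorizations. -/

section Rank

variable {K : Type*} [Field K] {m n : Type*} [Fintype m] [Fintype n]

lemma rank_add_le_add (A B : Matrix m n K) : (A + B).rank ≤ A.rank + B.rank := by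
  unfold Matrix.rank
  rw [Matrix.mulVecLin_add]
  exact (Submodule.finrank_mono (LinearMap.range_add_le _ _)).trans
    (Submodule.finrank_add_le_finrank_add_finrank _ _)

lemma rank_neg (A : Matrix m n K) : (-A).rank = A.rank := by
  rw [show -A = (-1 : K) • A by simp]
  exact Matrix.rank_smul_of_mem_nonZeroDivisors _ (by simp)

lemma rank_sub_comm (A B : Matrix m n K) : (A - B).rank = (B - A).rank := by
  rw [← rank_neg, neg_sub]

lemma rank_eq_zero_iff {A : Matrix m n K} : A.rank = 0 ↔ A = 0 := by
  classical
  constructor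
  · intro h
    have h1 : LinearMap.range A.mulVecLin = ⊥ := Submodule.finrank_eq_zero.mp h
    rw [LinearMap.range_eq_bot] at h1
    ext i j
    have := congrFun (LinearMap.congr_fun h1 (Pi.single j 1)) i
    simpa using this
  · rintro rfl
    exact Matrix.rank_zero

lemma vecMulVec_eq_zero_iff {u : m → K} {v : n → K} : vecMulVec u v = 0 ↔ u = 0 ∨ v = 0 := by
  constructor
  · intro h
    by_contra! hc
    obtain ⟨i, hi⟩ := Function.ne_iff.mp hc.1
    obtain ⟨j, hj⟩ := Function.ne_iff.mp hc.2
    have := congrFun (congrFun h i) j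
    simp [vecMulVec_apply] at this hi hj
    tauto
  · rintro (rfl | rfl) <;> ext <;> simp [vecMulVec_apply]

lemma rank_vecMulVec_eq_one {u : m → K} {v : n → K} (hu : u ≠ 0) (hv : v ≠ 0) :
    (vecMulVec u v).rank = 1 := by
  refine le_antisymm (Matrix.rank_vecMulVec_le _ _) ?_
  rw [Nat.one_le_iff_ne_zero, Ne, rank_eq_zero_iff, vecMulVec_eq_zero_iff]
  tauto

/-- The new range lies in the range of `A` and is annihilated by `l`, whereas `l` is nonzero on `A
*ᵥ w`; so the rank drops, and a rank one change cannot lower it by more than one. -/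
lemma rank_add_vecMulVec_of_dotProduct_eq_neg_one [DecidableEq n] {A : Matrix m n K} {w : n → K}
    {l : m → K} (h : l ⬝ᵥ A *ᵥ w = -1) :
    (A + vecMulVec (A *ᵥ w) (l ᵥ* A)).rank + 1 = A.rank := by
  set A' := A + vecMulVec (A *ᵥ w) (l ᵥ* A) with hA'
  have key : ∀ z, A' *ᵥ z = A *ᵥ z + ((l ᵥ* A) ⬝ᵥ z) • (A *ᵥ w) := by
    intro z
    rw [hA', add_mulVec, vecMulVec_mulVec]
    simp
  have hlt : A'.rank < A.rank := by
    refine Submodule.finrank_lt_finrank_of_lt (lt_of_le_of_ne ?_ ?_)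
    · rintro _ ⟨z, rfl⟩
      refine ⟨z + ((l ᵥ* A) ⬝ᵥ z) • w, ?_⟩
      simp [key, mulVec_add, mulVec_smul]
    · intro heq
      have : A *ᵥ w ∈ LinearMap.range A'.mulVecLin := by
        rw [heq]; exact ⟨w, rfl⟩
      obtain ⟨z, hz⟩ := this
      have hz' : A' *ᵥ z = A *ᵥ w := hz
      have h0 : l ⬝ᵥ A' *ᵥ z = 0 := by
        rw [key, dotProduct_add, dotProduct_smul, h, dotProduct_mulVec]
        simp
      rw [hz', h] at h0
      simp at h0
  have hle : A.rank ≤ A'.rank + 1 := by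
    have : A = A' + -vecMulVec (A *ᵥ w) (l ᵥ* A) := by rw [hA']; abel
    calc A.rank = (A' + -vecMulVec (A *ᵥ w) (l ᵥ* A)).rank := by rw [← this]
      _ ≤ _ := rank_add_le_add _ _
      _ ≤ _ := by rw [rank_neg]; gcongr; exact Matrix.rank_vecMulVec_le _ _
  omega

lemma rank_add_vecMulVec_mulVec_le [DecidableEq n] (A : Matrix m n K) (w : n → K) (v : n → K) :
    (A + vecMulVec (A *ᵥ w) v).rank ≤ A.rank := by
  have : A + vecMulVec (A *ᵥ w) v = A * (1 + vecMulVec w v) := by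
    rw [Matrix.mul_add, Matrix.mul_one, mul_vecMulVec]
  rw [this]
  exact Matrix.rank_mul_le_left _ _

/-- The perturbed matrix is `A` times `1 + w (lA)`, which is invertible by the Sherman–Morrison
formula because `1 + lAw ≠ 0`. -/
lemma rank_add_vecMulVec_of_dotProduct_ne_neg_one [DecidableEq n] {A : Matrix m n K} {w : n → K}
    {l : m → K} (h : l ⬝ᵥ A *ᵥ w ≠ -1) :
    (A + vecMulVec (A *ᵥ w) (l ᵥ* A)).rank = A.rank := by
  refine le_antisymm (rank_add_vecMulVec_mulVec_le _ _ _) ?_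
  set b := l ⬝ᵥ A *ᵥ w with hb
  have hb1 : 1 + b ≠ 0 := fun h0 => h (by linear_combination h0)
  have : A = (A + vecMulVec (A *ᵥ w) (l ᵥ* A)) * (1 - vecMulVec ((1 + b)⁻¹ • w) (l ᵥ* A)) := by
    rw [Matrix.mul_sub, Matrix.mul_one, Matrix.add_mul, mul_vecMulVec, vecMulVec_mul_vecMulVec, mulVec_smul]
    ext i j
    simp only [Matrix.sub_apply, Matrix.add_apply, vecMulVec_apply, Pi.smul_apply, smul_eq_mul,
      dotProduct_smul]
    rw [← dotProduct_mulVec, ← hb]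
    field_simp
    ring
  conv_lhs => rw [this]
  exact Matrix.rank_mul_le_left _ _

/-- Right multiplication by the projection `1 - zvᵀ` kills `uvᵀ` and fixes `A`, so `A` is a multiple
of the perturbed matrix. -/
lemma rank_le_rank_add_vecMulVec_right [DecidableEq n] {A : Matrix m n K} {z v : n → K}
    (hz : A *ᵥ z = 0) (hv : v ⬝ᵥ z = 1) (u : m → K) : A.rank ≤ (A + vecMulVec u v).rank := by
  have : A = (A + vecMulVec u v) * (1 - vecMulVec z v) := by
    rw [Matrix.mul_sub, Matrix.mul_one, Matrix.add_mul, mul_vecMulVec, vecMulVec_mul_vecMulVec, hz, hv]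
    simp
  conv_lhs => rw [this]
  exact Matrix.rank_mul_le_left _ _

lemma rank_add_vecMulVec_of_not_mem [DecidableEq m] [DecidableEq n] {A : Matrix m n K} {z v : n → K}
    {u : m → K} (hz : A *ᵥ z = 0) (hv : v ⬝ᵥ z = 1) (hu : ∀ w, u ≠ A *ᵥ w) :
    (A + vecMulVec u v).rank = A.rank + 1 := by
  refine le_antisymm ((rank_add_le_add _ _).trans
    (by gcongr; exact Matrix.rank_vecMulVec_le _ _)) ?_
  rw [Nat.succ_le_iff]
  refine Submodule.finrank_lt_finrank_of_lt (lt_of_le_of_ne ?_ ?_)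
  · rintro _ ⟨w, rfl⟩
    refine ⟨w - (v ⬝ᵥ w) • z, ?_⟩
    simp [mulVec_sub, mulVec_smul, vecMulVec_mulVec, hz, hv]
  · intro h
    have : u ∈ LinearMap.range (A + vecMulVec u v).mulVecLin :=
      ⟨z, by simp [vecMulVec_mulVec, hz, hv]⟩
    rw [← h] at this
    obtain ⟨w, hw⟩ := this
    exact hu w hw.symm

/-- A factorization of a matrix through `Fin k → K`, with one-sided inverses of the factors. -/
structure RankFactorization (B : Matrix m n K) (k : ℕ) where
  G : Matrix m (Fin k) K
  H : Matrix (Fin k) n K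
  L : Matrix (Fin k) m K
  R : Matrix n (Fin k) K
  mul_eq : G * H = B
  left_inv : L * G = 1
  right_inv : H * R = 1

lemma nonempty_rankFactorization [DecidableEq m] [DecidableEq n] (B : Matrix m n K) :
    Nonempty (RankFactorization B B.rank) := by
  let b : Module.Basis (Fin B.rank) K (LinearMap.range B.mulVecLin) := Module.finBasis _ _
  let g : (Fin B.rank → K) →ₗ[K] (m → K) :=
    (LinearMap.range B.mulVecLin).subtype ∘ₗ b.equivFun.symm.toLinearMap
  let h : (n → K) →ₗ[K] (Fin B.rank → K) := b.equivFun.toLinearMap ∘ₗ B.mulVecLin.rangeRestrict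
  have hg : LinearMap.ker g = ⊥ := by
    rw [LinearMap.ker_eq_bot]
    exact (Subtype.val_injective).comp b.equivFun.symm.injective
  have hh : LinearMap.range h = ⊤ := by
    rw [LinearMap.range_eq_top]
    exact b.equivFun.surjective.comp (LinearMap.surjective_rangeRestrict _)
  obtain ⟨l, hl⟩ := g.exists_leftInverse_of_injective hg
  obtain ⟨r, hr⟩ := h.exists_rightInverse_of_surjective hh
  refine ⟨⟨LinearMap.toMatrix' g, LinearMap.toMatrix' h, LinearMap.toMatrix' l,
    LinearMap.toMatrix' r, ?_, ?_, ?_⟩⟩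
  · rw [← LinearMap.toMatrix'_comp]
    have : g ∘ₗ h = Matrix.toLin' B := by
      ext1; ext1
      simp [g, h]
    rw [this, LinearMap.toMatrix'_toLin']
  · rw [← LinearMap.toMatrix'_comp, hl, LinearMap.toMatrix'_id]
  · rw [← LinearMap.toMatrix'_comp, hr, LinearMap.toMatrix'_id]

lemma rank_eq_one_iff {A : Matrix m n K} :
    A.rank = 1 ↔ ∃ u v, u ≠ 0 ∧ v ≠ 0 ∧ A = vecMulVec u v := by
  classical
  constructor
  · intro h
    obtain ⟨f⟩ := nonempty_rankFactorization A
    rw [h] at f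
    have hA : A = vecMulVec (fun i => f.G i 0) (fun j => f.H 0 j) := by
      ext i j
      conv_lhs => rw [← f.mul_eq]
      simp [Matrix.mul_apply, vecMulVec_apply]
    have h0 : ¬ (A = 0) := by
      rw [← rank_eq_zero_iff]; omega
    rw [hA, vecMulVec_eq_zero_iff] at h0
    push Not at h0
    exact ⟨_, _, h0.1, h0.2, hA⟩
  · rintro ⟨u, v, hu, hv, rfl⟩
    exact rank_vecMulVec_eq_one hu hv

/-- One elimination step at a nonzero entry: subtract column `j` times row `i` divided by `A i j`.
Iterating it produces geodesics in the graph. -/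
lemma exists_rank_sub [DecidableEq n] {A : Matrix m n K} (hA : A ≠ 0) :
    ∃ s : Matrix m n K, s.rank = 1 ∧ (A - s).rank + 1 = A.rank := by
  classical
  obtain ⟨i, j, hij⟩ : ∃ i j, A i j ≠ 0 := by
    by_contra! h
    exact hA (by ext i j; exact h i j)
  have h : (Pi.single i (1 : K)) ⬝ᵥ A *ᵥ (Pi.single j (-(A i j)⁻¹)) = -1 := by
    simp [hij]
  have h2 := rank_add_vecMulVec_of_dotProduct_eq_neg_one h
  refine ⟨-vecMulVec (A *ᵥ (Pi.single j (-(A i j)⁻¹))) (Pi.single i (1 : K) ᵥ* A), ?_, ?_⟩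
  · rw [rank_neg]
    apply rank_vecMulVec_eq_one
    · intro h0
      rw [h0] at h
      simp at h
    · intro h0
      rw [dotProduct_mulVec, h0] at h
      simp at h
  · rwa [sub_neg_eq_add]

end Rank

/-! ### Distance is the rank of the difference. -/

section Dist

variable {F : Type*} [Field F] [Fintype F] [DecidableEq F] {D N : ℕ}

lemma graph_adj {x y : Vertex F D N} : (graph F D N).Adj x y ↔ (x - y).rank = 1 := Iff.rfl

lemma rank_sub_le_length {x y : Vertex F D N} (p : (graph F D N).Walk x y) :
    (x - y).rank ≤ p.length := by
  induction p with
  | nil => simp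
  | @cons u v w h p ih =>
    rw [SimpleGraph.Walk.length_cons]
    have h1 : (u - w) = (u - v) + (v - w) := by abel
    have h2 := rank_add_le_add (u - v) (v - w)
    rw [← h1] at h2
    rw [graph_adj] at h
    omega

lemma exists_walk_length_eq_rank (k : ℕ) : ∀ x y : Vertex F D N, (x - y).rank = k →
    ∃ p : (graph F D N).Walk x y, p.length = k := by
  induction k with
  | zero =>
    intro x y h
    rw [rank_eq_zero_iff, sub_eq_zero] at h
    subst h
    exact ⟨.nil, rfl⟩
  | succ k ih =>
    intro x y h
    obtain ⟨s, hs, hs'⟩ := exists_rank_sub (A := x - y) (by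
      rw [Ne, ← rank_eq_zero_iff]; omega)
    obtain ⟨p, hp⟩ := ih (x - s) y (by
      rw [show x - s - y = x - y - s by abel]; omega)
    exact ⟨.cons (show (graph F D N).Adj x (x - s) by rw [graph_adj]; simpa using hs) p, by
      simp [hp]⟩

lemma graph_dist (x y : Vertex F D N) : (graph F D N).dist x y = (x - y).rank := by
  obtain ⟨p, hp⟩ := exists_walk_length_eq_rank _ x y rfl
  refine le_antisymm (hp ▸ SimpleGraph.dist_le p) ?_
  obtain ⟨p', hp'⟩ := (SimpleGraph.Walk.reachable p).exists_walk_length_eq_dist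
  rw [← hp']
  exact rank_sub_le_length p'

lemma mem_sphere {i : ℕ} {x z : Vertex F D N} :
    z ∈ sphere (graph F D N) i x ↔ (z - x).rank = i := by
  rw [sphere, Finset.mem_filter, graph_dist, rank_sub_comm]
  simp

end Dist

/-! ### Additive characters and sums over rank one matrices. -/

section Characters

variable (F : Type*) [Field F] [Fintype F] [DecidableEq F]

/-- A nontrivial additive character of the finite field `F`. -/
noncomputable def chi : AddChar F ℂ := AddChar.FiniteField.primitiveChar_to_Complex F

lemma chi_isPrimitive : (chi F).IsPrimitive :=
  AddChar.FiniteField.primitiveChar_to_Complex_isPrimitive F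

/-- The order of the field as a real number. -/
noncomputable def qr : ℝ := (Fintype.card F : ℝ)

lemma one_lt_qr : 1 < qr F := by
  unfold qr
  exact_mod_cast Fintype.one_lt_card

variable {F}

lemma chi_neg (t : F) : chi F (-t) = (starRingEnd ℂ) (chi F t) :=
  AddChar.map_neg_eq_conj _ _

lemma chi_mul_conj (t : F) : chi F t * (starRingEnd ℂ) (chi F t) = 1 := by
  rw [← chi_neg, ← AddChar.map_add_eq_mul]
  simp

lemma exists_chi_ne_one {c : F} (hc : c ≠ 0) : ∃ t, chi F (t * c) ≠ 1 := by
  have h : (chi F).mulShift c ≠ 1 := chi_isPrimitive F hc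
  by_contra! h'
  apply h
  ext t
  rw [AddChar.mulShift_apply, mul_comm]
  simpa using h' t

lemma sum_chi_mul (c : F) : ∑ t, chi F (t * c) = if c = 0 then (qr F : ℂ) else 0 := by
  rw [AddChar.sum_mulShift c (chi_isPrimitive F)]
  simp [qr]

/-- Translating by a vector on which `χ ∘ l` is not `1` multiplies the sum by that value, so the sum
is zero. -/
lemma sum_chi_linearMap {V : Type*} [AddCommGroup V] [Module F V] [Fintype V] (l : V →ₗ[F] F)
    [Decidable (l = 0)] : ∑ v, chi F (l v) = if l = 0 then (Fintype.card V : ℂ) else 0 := by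
  split_ifs with h
  · simp [h]
  · obtain ⟨v, hv⟩ : ∃ v, l v ≠ 0 := by
      by_contra! h'
      exact h (LinearMap.ext h')
    obtain ⟨t, ht⟩ := exists_chi_ne_one hv
    have h1 : ∑ w, chi F (l w) = chi F (t * l v) * ∑ w, chi F (l w) := by
      rw [Finset.mul_sum]
      refine (Fintype.sum_equiv (Equiv.addLeft (t • v)) _ _ fun w => ?_).symm
      simp [AddChar.map_add_eq_mul]
    have h2 : (chi F (t * l v) - 1) * ∑ w, chi F (l w) = 0 := by
      linear_combination -h1
    exact (mul_eq_zero.mp h2).resolve_left (sub_ne_zero.mpr ht)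

variable {m n : Type*} [Fintype m] [Fintype n] [DecidableEq m] [DecidableEq n]

lemma sum_chi_dotProduct (w : m → F) :
    ∑ u : m → F, chi F (u ⬝ᵥ w) = if w = 0 then (qr F : ℂ) ^ Fintype.card m else 0 := by
  let l : (m → F) →ₗ[F] F := (dotProductBilin F F).flip w
  have hl : ∀ u, l u = u ⬝ᵥ w := fun u => rfl
  have h0 : l = 0 ↔ w = 0 := by
    constructor
    · intro h
      ext i
      have := LinearMap.congr_fun h (Pi.single i 1)
      rw [hl] at this
      simpa using this
    · rintro rfl
      ext; simp [hl]
  classical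
  have := sum_chi_linearMap l
  simp only [hl, h0] at this
  rw [this]
  simp [qr]

/-- The bilinear pairing `∑ Aᵢⱼ zᵢⱼ` of matrices. -/
def pairing (A z : Matrix m n F) : F := ∑ i, ∑ j, A i j * z i j

lemma pairing_comm (A z : Matrix m n F) : pairing A z = pairing z A := by
  simp [pairing, mul_comm]

lemma pairing_add (A z w : Matrix m n F) : pairing A (z + w) = pairing A z + pairing A w := by
  simp [pairing, mul_add, Finset.sum_add_distrib]

lemma pairing_sub (A z w : Matrix m n F) : pairing A (z - w) = pairing A z - pairing A w := by
  simp [pairing, mul_sub, Finset.sum_sub_distrib]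

lemma pairing_smul (A : Matrix m n F) (c : F) (z : Matrix m n F) :
    pairing A (c • z) = c * pairing A z := by
  simp [pairing, Finset.mul_sum, mul_left_comm]

lemma pairing_vecMulVec (A : Matrix m n F) (u : m → F) (v : n → F) :
    pairing A (vecMulVec u v) = u ⬝ᵥ A *ᵥ v := by
  simp only [pairing, vecMulVec_apply, dotProduct, mulVec, Finset.mul_sum]
  exact Finset.sum_congr rfl fun i _ => Finset.sum_congr rfl fun j _ => by ring

lemma sum_chi_pairing (z : Matrix m n F) :
    ∑ A : Matrix m n F, chi F (pairing A z) =
      if z = 0 then (Fintype.card (Matrix m n F) : ℂ) else 0 := by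
  let l : Matrix m n F →ₗ[F] F :=
    { toFun := pairing z
      map_add' := pairing_add z
      map_smul' := fun c w => pairing_smul z c w }
  have hl : ∀ u, l u = pairing u z := fun u => pairing_comm _ _
  have h0 : l = 0 ↔ z = 0 := by
    constructor
    · intro h
      ext i j
      have := LinearMap.congr_fun h (Matrix.single i j 1)
      rw [hl] at this
      simpa [pairing, Matrix.single_apply, ite_and] using this
    · rintro rfl
      ext; simp [hl, pairing]
  classical
  have := sum_chi_linearMap l
  simp only [hl, h0] at this
  rw [this]

/-- Pairs of nonzero vectors. -/
def pairs (m n F : Type*) [Field F] [Fintype F] [DecidableEq F] [Fintype m] [Fintype n]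
    [DecidableEq m] [DecidableEq n] : Finset ((m → F) × (n → F)) :=
  Finset.univ.filter fun p => p.1 ≠ 0 ∧ p.2 ≠ 0

lemma mem_pairs {p : (m → F) × (n → F)} : p ∈ pairs m n F ↔ p.1 ≠ 0 ∧ p.2 ≠ 0 := by
  simp [pairs]

lemma vecMulVec_eq_iff {u u' : m → F} {v v' : n → F} (hu : u ≠ 0) (hv : v ≠ 0) :
    vecMulVec u' v' = vecMulVec u v ↔ ∃ c : Fˣ, u' = (c : F) • u ∧ v' = ((c⁻¹ : Fˣ) : F) • v := by
  constructor
  · intro h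
    have h' : ∀ i j, u' i * v' j = u i * v j := fun i j => congrFun (congrFun h i) j
    obtain ⟨i, hi⟩ := Function.ne_iff.mp hu
    obtain ⟨j, hj⟩ := Function.ne_iff.mp hv
    simp only [Pi.zero_apply] at hi hj
    have hij : u' i * v' j ≠ 0 := by rw [h']; exact mul_ne_zero hi hj
    have hui : u' i ≠ 0 := left_ne_zero_of_mul hij
    have hvj : v' j ≠ 0 := right_ne_zero_of_mul hij
    refine ⟨Units.mk0 (u' i / u i) (div_ne_zero hui hi), ?_, ?_⟩
    · ext l
      simp only [Units.val_mk0, Pi.smul_apply, smul_eq_mul]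
      have h1 := h' l j
      have h2 := h' i j
      field_simp
      apply mul_right_cancel₀ hvj
      apply mul_right_cancel₀ hj
      linear_combination (u i * v j) * h1 - u l * v j * h2
    · ext l
      simp only [Units.val_mk0, Units.val_inv_eq_inv_val, Pi.smul_apply, smul_eq_mul]
      have h1 := h' i l
      field_simp
      linear_combination h1
  · rintro ⟨c, rfl, rfl⟩
    ext i j
    simp [vecMulVec_apply]
    field_simp

lemma card_fiber_vecMulVec {s : Matrix m n F} (hs : s.rank = 1) :
    ((pairs m n F).filter fun p => vecMulVec p.1 p.2 = s).card = Fintype.card F - 1 := by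
  obtain ⟨u, v, hu, hv, rfl⟩ := rank_eq_one_iff.mp hs
  rw [← Fintype.card_units]
  symm
  refine Finset.card_bij (fun (c : Fˣ) _ => ((c : F) • u, ((c⁻¹ : Fˣ) : F) • v)) ?_ ?_ ?_
  · intro c _
    rw [Finset.mem_filter, mem_pairs]
    refine ⟨⟨?_, ?_⟩, (vecMulVec_eq_iff hu hv).mpr ⟨c, rfl, rfl⟩⟩
    · simp [hu]
    · simp [hv]
  · intro c _ d _ h
    have := congrArg Prod.fst h
    exact Units.ext (smul_left_injective F hu this)
  · rintro ⟨u', v'⟩ h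
    obtain ⟨c, h1, h2⟩ := (vecMulVec_eq_iff hu hv).mp (Finset.mem_filter.mp h).2
    exact ⟨c, Finset.mem_univ _, by simp only at h1 h2; rw [h1, h2]⟩

/-- A rank one matrix is `uvᵀ` in exactly `q - 1` ways, so sums over rank one matrices become double
sums over vectors. -/
lemma sum_pairs (f : Matrix m n F → ℂ) :
    ∑ p ∈ pairs m n F, f (vecMulVec p.1 p.2) =
      (qr F - 1) * ∑ s ∈ Finset.univ.filter (fun s : Matrix m n F => s.rank = 1), f s := by
  rw [← Finset.sum_fiberwise_of_maps_to
    (t := Finset.univ.filter (fun s : Matrix m n F => s.rank = 1))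
    (g := fun p => vecMulVec p.1 p.2), Finset.mul_sum]
  · refine Finset.sum_congr rfl fun s hs => ?_
    rw [Finset.sum_congr rfl (g := fun _ => f s), Finset.sum_const,
      card_fiber_vecMulVec (Finset.mem_filter.mp hs).2, nsmul_eq_mul,
      Nat.cast_sub Fintype.card_pos]
    · simp [qr]
    · intro p hp
      rw [(Finset.mem_filter.mp hp).2]
  · intro p hp
    rw [mem_pairs] at hp
    simpa using rank_vecMulVec_eq_one hp.1 hp.2

/-- Inclusion-exclusion for a sum over pairs of nonzero vectors. -/
lemma sum_pairs_eq (g : (m → F) → (n → F) → ℂ) :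
    ∑ p ∈ pairs m n F, g p.1 p.2 =
      ∑ u, ∑ v, g u v - ∑ u, g u 0 - ∑ v, g 0 v + g 0 0 := by
  have h1 : ∑ p ∈ pairs m n F, g p.1 p.2 =
      ∑ u ∈ Finset.univ.erase 0, ∑ v ∈ Finset.univ.erase 0, g u v := by
    rw [← Finset.sum_product']
    refine Finset.sum_congr ?_ fun _ _ => rfl
    ext p
    simp [mem_pairs]
  have h2 : ∀ u, ∑ v ∈ Finset.univ.erase 0, g u v = ∑ v, g u v - g u 0 := fun u => by
    rw [← Finset.add_sum_erase _ _ (Finset.mem_univ (0 : n → F))]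
    ring
  rw [h1]
  simp only [h2]
  rw [Finset.sum_sub_distrib, ← Finset.add_sum_erase (a := (0 : m → F)) Finset.univ
      (fun u => ∑ v, g u v) (Finset.mem_univ _),
    ← Finset.add_sum_erase (a := (0 : m → F)) Finset.univ (fun u => g u 0) (Finset.mem_univ _)]
  ring

lemma card_mulVec_eq_zero (A : Matrix m n F) :
    (Finset.univ.filter fun v : n → F => A *ᵥ v = 0).card =
      Fintype.card F ^ (Fintype.card n - A.rank) := by
  have h1 := LinearMap.finrank_range_add_finrank_ker A.mulVecLin
  rw [Module.finrank_fintype_fun_eq_card] at h1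
  have h2 : Module.finrank F (LinearMap.ker A.mulVecLin) = Fintype.card n - A.rank := by
    unfold Matrix.rank; omega
  classical
  have h3 := Module.card_eq_pow_finrank (K := F) (V := LinearMap.ker A.mulVecLin)
  rw [← h2, ← h3, ← Fintype.card_subtype]
  exact Fintype.card_congr (Equiv.refl _)

variable (F m n) in
/-- The eigenvalue of rank `j`. -/
noncomputable def theta (j : ℕ) : ℝ :=
  (qr F ^ (Fintype.card m + (Fintype.card n - j)) - qr F ^ Fintype.card m - qr F ^ Fintype.card n
    + 1) / (qr F - 1)

/-- Summing over `u` first leaves only the `v` in the kernel of `A`, whose size depends on the rank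
alone; inclusion-exclusion removes the pairs with a zero vector. -/
lemma sum_rank_one_chi (A : Matrix m n F) :
    ∑ s ∈ Finset.univ.filter (fun s : Matrix m n F => s.rank = 1), chi F (pairing A s) =
      (theta F m n A.rank : ℂ) := by
  have hq : (qr F : ℂ) - 1 ≠ 0 := by
    have := one_lt_qr F
    exact_mod_cast sub_ne_zero.mpr this.ne'
  apply mul_left_cancel₀ hq
  rw [← sum_pairs]
  simp only [pairing_vecMulVec]
  rw [sum_pairs_eq fun u v => chi F (u ⬝ᵥ A *ᵥ v), Finset.sum_comm]
  simp only [sum_chi_dotProduct]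
  rw [← Finset.sum_filter, Finset.sum_const, card_mulVec_eq_zero]
  simp only [mulVec_zero, dotProduct_zero, zero_dotProduct, AddChar.map_zero_eq_one,
    Finset.sum_const, Finset.card_univ, Fintype.card_fun, theta]
  push_cast
  rw [mul_div_cancel₀ _ hq]
  simp [qr, pow_add]
  ring

end Characters

/-! ### Spectrum, the idempotent `E` and its kernel. -/

section Idempotent

variable {F : Type*} [Field F] [Fintype F] [DecidableEq F] {D N : ℕ}

lemma theta_lt {m n : Type*} [Fintype m] [Fintype n] {i j : ℕ} (hij : i < j)
    (hj : j ≤ Fintype.card n) : theta F m n j < theta F m n i := by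
  have h := one_lt_qr F
  unfold theta
  have h1 : qr F ^ (Fintype.card m + (Fintype.card n - j)) <
      qr F ^ (Fintype.card m + (Fintype.card n - i)) := pow_lt_pow_right₀ h (by omega)
  have h2 : 0 < qr F - 1 := by linarith
  gcongr

/-- The real part of the projection onto the character indexed by `A`. -/
noncomputable def charProj (A : Vertex F D N) : Matrix (Vertex F D N) (Vertex F D N) ℝ :=
  fun z w => (Fintype.card (Vertex F D N) : ℝ)⁻¹ * (chi F (pairing A (z - w))).re

lemma adjacency_apply (z w : Vertex F D N) :
    adjacency (graph F D N) z w = if (z - w).rank = 1 then 1 else 0 := by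
  simp only [adjacency, SimpleGraph.adjMatrix_apply, graph_adj]

/-- In a Cayley graph a character is an eigenvector whose eigenvalue is its sum over the connection
set, here the rank one matrices. That sum is real, so passing to real parts is harmless. -/
lemma adjacency_mul_charProj (A : Vertex F D N) :
    adjacency (graph F D N) * charProj A =
      theta F (Fin D) (Fin (N - D)) A.rank • charProj A := by
  ext z w
  rw [Matrix.mul_apply, Matrix.smul_apply, smul_eq_mul]
  simp only [adjacency_apply, charProj, ite_mul, one_mul, zero_mul]
  rw [← Finset.sum_filter, ← Finset.mul_sum, mul_left_comm]
  congr 1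
  have h1 : ∑ t ∈ Finset.univ.filter (fun t : Vertex F D N => (z - t).rank = 1),
      chi F (pairing A (t - w)) = theta F (Fin D) (Fin (N - D)) A.rank *
        chi F (pairing A (z - w)) := by
    rw [← sum_rank_one_chi, Finset.sum_mul]
    refine Finset.sum_bij' (fun t _ => t - z) (fun s _ => s + z) ?_ ?_ ?_ ?_ ?_
    · intro t ht
      rw [Finset.mem_filter] at ht ⊢
      exact ⟨Finset.mem_univ _, by rw [rank_sub_comm]; exact ht.2⟩
    · intro t ht
      rw [Finset.mem_filter] at ht ⊢
      exact ⟨Finset.mem_univ _, by rw [rank_sub_comm]; simpa using ht.2⟩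
    · intro t _; simp
    · intro t _; simp
    · intro t _
      rw [← AddChar.map_add_eq_mul, ← pairing_add]
      congr 2
      abel
  rw [← Complex.re_sum, h1, Complex.re_ofReal_mul]

lemma sum_charProj : ∑ A : Vertex F D N, charProj A = 1 := by
  ext z w
  rw [Matrix.sum_apply]
  simp only [charProj]
  rw [← Finset.mul_sum, ← Complex.re_sum, sum_chi_pairing, Matrix.one_apply]
  simp only [sub_eq_zero]
  split_ifs with h
  · simp
  · simp

lemma toEuclideanLin_charProj_mem (A : Vertex F D N) (v : EuclideanSpace ℝ (Vertex F D N)) :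
    Matrix.toEuclideanLin (charProj A) v ∈
      Module.End.eigenspace (Matrix.toEuclideanLin (adjacency (graph F D N)))
        (theta F (Fin D) (Fin (N - D)) A.rank) := by
  rw [Module.End.mem_eigenspace_iff]
  apply WithLp.ofLp_injective
  have h := congrArg (fun M => M *ᵥ v.ofLp) (adjacency_mul_charProj A)
  simp only [← Matrix.mulVec_mulVec, Matrix.smul_mulVec] at h
  exact h

lemma sum_toEuclideanLin_charProj (v : EuclideanSpace ℝ (Vertex F D N)) :
    ∑ A : Vertex F D N, Matrix.toEuclideanLin (charProj A) v = v := by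
  rw [← LinearMap.sum_apply, ← map_sum, sum_charProj]
  apply WithLp.ofLp_injective
  exact Matrix.one_mulVec _

/-- The character projections of `v` add up to `v`; an eigenvector for any other value would be
orthogonal to each of them, hence to itself. -/
lemma mem_eigenvalueSet_iff {μ : ℝ} : μ ∈ eigenvalueSet (graph F D N) ↔
    ∃ A : Vertex F D N, μ = theta F (Fin D) (Fin (N - D)) A.rank := by
  constructor
  · intro hμ
    obtain ⟨v, hv⟩ := hμ.exists_hasEigenvector
    by_contra! hne
    apply hv.2
    rw [← inner_self_eq_zero (𝕜 := ℝ)]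
    conv_lhs => rw [← sum_toEuclideanLin_charProj v, sum_inner]
    refine Finset.sum_eq_zero fun A _ => ?_
    have hs : (Matrix.toEuclideanLin (adjacency (graph F D N))).IsSymmetric :=
      Matrix.isSymmetric_toEuclideanLin_iff.mpr (adjacency_isHermitian _)
    rw [sum_toEuclideanLin_charProj v]
    exact hs.orthogonalFamily_eigenspaces (hne A).symm
      ⟨_, toEuclideanLin_charProj_mem A v⟩ ⟨v, hv.1⟩
  · rintro ⟨A, rfl⟩
    refine Module.End.hasEigenvalue_of_hasEigenvector
      (x := Matrix.toEuclideanLin (charProj A) (EuclideanSpace.single 0 1))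
      ⟨toEuclideanLin_charProj_mem _ _, fun h => ?_⟩
    have h1 : (charProj A *ᵥ (Pi.single 0 1 : Vertex F D N → ℝ)) 0 = 0 :=
      congrArg (fun v : EuclideanSpace ℝ (Vertex F D N) => v.ofLp 0) h
    rw [Matrix.mulVec_single_one] at h1
    simp [charProj, pairing] at h1

lemma rank_le_sub (A : Vertex F D N) : A.rank ≤ N - D := by
  simpa using Matrix.rank_le_card_width A

lemma exists_rank_eq_one (hD : 0 < D) (hN : D < N) : ∃ A : Vertex F D N, A.rank = 1 := by
  refine ⟨vecMulVec (fun _ => 1) (fun _ => 1), rank_vecMulVec_eq_one ?_ ?_⟩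
  · exact fun h => one_ne_zero (congrFun h ⟨0, hD⟩)
  · exact fun h => one_ne_zero (congrFun h ⟨0, by omega⟩)

lemma theta_le {m n : Type*} [Fintype m] [Fintype n] {i j : ℕ} (hij : i ≤ j)
    (hj : j ≤ Fintype.card n) : theta F m n j ≤ theta F m n i := by
  rcases hij.eq_or_lt with rfl | h
  · rfl
  · exact (theta_lt h hj).le

lemma eigenvalue_zero :
    eigenvalue (graph F D N) 0 = theta F (Fin D) (Fin (N - D)) 0 := by
  rw [eigenvalue]
  apply IsGreatest.csSup_eq
  constructor
  · rw [mem_eigenvalueSet_iff]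
    exact ⟨0, by rw [Matrix.rank_zero]⟩
  · intro μ hμ
    obtain ⟨A, rfl⟩ := mem_eigenvalueSet_iff.mp hμ
    exact theta_le (Nat.zero_le _) (by simpa using rank_le_sub A)

lemma eigenvalue_one (hD : 0 < D) (hN : D < N) :
    eigenvalue (graph F D N) 1 = theta F (Fin D) (Fin (N - D)) 1 := by
  rw [eigenvalue, eigenvalue_zero]
  apply IsGreatest.csSup_eq
  constructor
  · obtain ⟨A, hA⟩ := exists_rank_eq_one (F := F) hD hN
    exact ⟨mem_eigenvalueSet_iff.mpr ⟨A, by rw [hA]⟩, theta_lt one_pos (by simp; omega)⟩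
  · rintro μ ⟨hμ, hlt⟩
    obtain ⟨A, rfl⟩ := mem_eigenvalueSet_iff.mp hμ
    refine theta_le ?_ (by simpa using rank_le_sub A)
    rw [Nat.one_le_iff_ne_zero]
    intro h
    rw [h] at hlt
    exact hlt.false

lemma idem_eq_sum (hD : 0 < D) (hN : D < N) :
    idem F D N = ∑ A ∈ Finset.univ.filter (fun A : Vertex F D N => A.rank = 1), charProj A := by
  apply Matrix.toEuclideanLin.injective
  ext1 v
  conv_lhs => rw [← sum_toEuclideanLin_charProj v]
  rw [map_sum, map_sum, LinearMap.sum_apply, Finset.sum_filter]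
  refine Finset.sum_congr rfl fun A _ => ?_
  rw [idem, eigenvalue_one hD hN]
  split_ifs with h
  · exact primitiveIdempotent_apply_self _ _ _ (h ▸ toEuclideanLin_charProj_mem A v)
  · refine primitiveIdempotent_apply_of_ne _ _ _ (fun h' => h ?_) _
      (toEuclideanLin_charProj_mem A v)
    rcases lt_trichotomy A.rank 1 with h1 | h1 | h1
    · exact absurd h' (theta_lt h1 (by simp; omega)).ne'
    · exact h1
    · exact absurd h' (theta_lt h1 (by simpa using rank_le_sub A)).ne

/-- Self-duality: by symmetry of the pairing, summing over characters of rank one at `z - w` is the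
sum that computed the eigenvalues. -/
lemma idem_apply (hD : 0 < D) (hN : D < N) (z w : Vertex F D N) :
    idem F D N z w = (Fintype.card (Vertex F D N) : ℝ)⁻¹ *
      theta F (Fin D) (Fin (N - D)) (z - w).rank := by
  rw [idem_eq_sum hD hN, Matrix.sum_apply]
  simp only [charProj]
  rw [← Finset.mul_sum, ← Complex.re_sum]
  simp only [pairing_comm _ (z - w)]
  rw [sum_rank_one_chi, Complex.ofReal_re]

lemma dualEigenvalue_dist (hD : 0 < D) (hN : D < N) (z w : Vertex F D N) :
    dualEigenvalue (graph F D N) (idem F D N) ((graph F D N).dist z w) =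
      theta F (Fin D) (Fin (N - D)) (z - w).rank := by
  have h : ∃ p : Vertex F D N × Vertex F D N,
      (graph F D N).dist p.1 p.2 = (graph F D N).dist z w := ⟨(z, w), rfl⟩
  rw [dualEigenvalue, dif_pos h, idem_apply hD hN, mul_inv_cancel_left₀ (by simp),
    ← graph_dist, h.choose_spec, graph_dist]

lemma idemMap_inner (u v : EuclideanSpace ℝ (Vertex F D N)) :
    inner ℝ (idemMap F D N u) (idemMap F D N v) = inner ℝ u (idemMap F D N v) := by
  simp only [idemMap, idem, primitiveIdempotent, LinearEquiv.apply_symm_apply]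
  set U := Module.End.eigenspace (Matrix.toEuclideanLin (adjacency (graph F D N)))
    (eigenvalue (graph F D N) 1)
  change inner ℝ (U.starProjection u) (U.starProjection v) = inner ℝ u (U.starProjection v)
  rw [Submodule.inner_starProjection_left_eq_right]
  congr 1
  exact Submodule.starProjection_eq_self_iff.mpr (Submodule.starProjection_apply_mem _ _)

/-- The Fourier transform of a vector at the rank one matrix `abᵀ`. -/
noncomputable def fourier (v : EuclideanSpace ℝ (Vertex F D N)) (a : Fin D → F)
    (b : Fin (N - D) → F) : ℂ :=
  ∑ w, (v.ofLp w : ℂ) * chi F (a ⬝ᵥ w *ᵥ b)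

lemma pairing_vecMulVec_left (a : Fin D → F) (b : Fin (N - D) → F) (w : Vertex F D N) :
    pairing (vecMulVec a b) w = a ⬝ᵥ w *ᵥ b := by
  rw [pairing_comm, pairing_vecMulVec]

lemma charProj_vecMulVec_mulVec (v : EuclideanSpace ℝ (Vertex F D N)) (a : Fin D → F)
    (b : Fin (N - D) → F) (z : Vertex F D N) :
    (charProj (vecMulVec a b) *ᵥ v.ofLp) z = (Fintype.card (Vertex F D N) : ℝ)⁻¹ *
      (chi F (a ⬝ᵥ z *ᵥ b) * (starRingEnd ℂ) (fourier v a b)).re := by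
  rw [fourier, map_sum, Finset.mul_sum, Complex.re_sum, Finset.mul_sum]
  simp only [mulVec, dotProduct]
  refine Finset.sum_congr rfl fun w _ => ?_
  change charProj (vecMulVec a b) z w * v.ofLp w = _ * (chi F (a ⬝ᵥ z *ᵥ b) *
    (starRingEnd ℂ) ((v.ofLp w : ℂ) * chi F (a ⬝ᵥ w *ᵥ b))).re
  rw [charProj, pairing_sub, sub_eq_add_neg, AddChar.map_add_eq_mul, chi_neg,
    pairing_vecMulVec_left, pairing_vecMulVec_left, map_mul, Complex.conj_ofReal,
    mul_left_comm, Complex.re_ofReal_mul]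
  ring

lemma inner_charProj (v : EuclideanSpace ℝ (Vertex F D N)) (a : Fin D → F)
    (b : Fin (N - D) → F) :
    inner ℝ v (Matrix.toEuclideanLin (charProj (vecMulVec a b)) v) =
      (Fintype.card (Vertex F D N) : ℝ)⁻¹ * Complex.normSq (fourier v a b) := by
  rw [PiLp.inner_apply]
  have : ∀ z, inner ℝ (v.ofLp z) ((Matrix.toEuclideanLin (charProj (vecMulVec a b)) v).ofLp z) =
      (Fintype.card (Vertex F D N) : ℝ)⁻¹ *
      ((v.ofLp z * chi F (a ⬝ᵥ z *ᵥ b)) * (starRingEnd ℂ) (fourier v a b)).re := by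
    intro z
    change (charProj (vecMulVec a b) *ᵥ v.ofLp) z * v.ofLp z = _
    rw [charProj_vecMulVec_mulVec, mul_assoc, mul_assoc, Complex.re_ofReal_mul]
    ring
  rw [Finset.sum_congr rfl fun z _ => this z, ← Finset.mul_sum, ← Complex.re_sum,
    ← Finset.sum_mul]
  change _ * (fourier v a b * (starRingEnd ℂ) (fourier v a b)).re = _
  rw [Complex.mul_conj, Complex.ofReal_re]

/-- `⟨v, Ev⟩` is a positive multiple of the sum of the `|fourier v a b|²` over the rank one matrices
`abᵀ`, so it vanishes only if every term does. -/
lemma idemMap_eq_zero_iff (hD : 0 < D) (hN : D < N) (v : EuclideanSpace ℝ (Vertex F D N)) :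
    idemMap F D N v = 0 ↔ ∀ a b, a ≠ 0 → b ≠ 0 → fourier v a b = 0 := by
  have hsum : idemMap F D N v = ∑ A ∈ Finset.univ.filter (fun A : Vertex F D N => A.rank = 1),
      Matrix.toEuclideanLin (charProj A) v := by
    rw [idemMap, idem_eq_sum hD hN, map_sum, LinearMap.sum_apply]
  constructor
  · intro h a b ha hb
    have h1 : inner ℝ v (idemMap F D N v) = 0 := by rw [h, inner_zero_right]
    rw [hsum, inner_sum, Finset.sum_eq_zero_iff_of_nonneg] at h1
    · have h2 := h1 (vecMulVec a b) (by simpa using rank_vecMulVec_eq_one ha hb)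
      rw [inner_charProj] at h2
      simpa using h2
    · intro A hA
      obtain ⟨a, b, -, -, rfl⟩ := rank_eq_one_iff.mp (Finset.mem_filter.mp hA).2
      rw [inner_charProj]
      exact mul_nonneg (by positivity) (Complex.normSq_nonneg _)
  · intro h
    rw [hsum]
    refine Finset.sum_eq_zero fun A hA => ?_
    obtain ⟨a, b, ha, hb, rfl⟩ := rank_eq_one_iff.mp (Finset.mem_filter.mp hA).2
    apply WithLp.ofLp_injective
    ext z
    change (charProj (vecMulVec a b) *ᵥ v.ofLp) z = 0
    rw [charProj_vecMulVec_mulVec, h a b ha hb]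
    simp

end Idempotent

/-! ### The rank of `B + uvᵀ` in terms of row and column spaces. -/

namespace RankFactorization

variable {F : Type*} [Field F] {m n : Type*} [Fintype m] [Fintype n]
  {B : Matrix m n F} {k : ℕ} (f : RankFactorization B k)

/-- The factorization of the transposed matrix. -/
def transpose : RankFactorization Bᵀ k where
  G := f.Hᵀ
  H := f.Gᵀ
  L := f.Rᵀ
  R := f.Lᵀ
  mul_eq := by rw [← Matrix.transpose_mul, f.mul_eq]
  left_inv := by rw [← Matrix.transpose_mul, f.right_inv, Matrix.transpose_one]
  right_inv := by rw [← Matrix.transpose_mul, f.left_inv, Matrix.transpose_one]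

/-- Membership in the column space. -/
def IsCol (u : m → F) : Prop := ∃ u', u = f.G *ᵥ u'

/-- Membership in the row space. -/
def IsRow (v : n → F) : Prop := ∃ v', v = v' ᵥ* f.H

lemma transpose_isCol {v : n → F} : f.transpose.IsCol v ↔ f.IsRow v := by
  simp [IsCol, IsRow, transpose, mulVec_transpose]

lemma transpose_isRow {u : m → F} : f.transpose.IsRow u ↔ f.IsCol u := by
  simp [IsCol, IsRow, transpose, vecMul_transpose]

lemma L_G (u' : Fin k → F) : f.L *ᵥ f.G *ᵥ u' = u' := by
  rw [mulVec_mulVec, f.left_inv, one_mulVec]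

lemma G_injective : Function.Injective fun u' => f.G *ᵥ u' :=
  Function.LeftInverse.injective f.L_G

lemma H_R (v' : Fin k → F) : (v' ᵥ* f.H) ᵥ* f.R = v' := by
  rw [vecMul_vecMul, f.right_inv, vecMul_one]

lemma H_injective : Function.Injective fun v' => v' ᵥ* f.H :=
  Function.LeftInverse.injective (g := fun v => v ᵥ* f.R) f.H_R

lemma rank_eq (f : RankFactorization B k) : B.rank = k := by
  refine le_antisymm ?_ ?_
  · rw [← f.mul_eq]
    exact (Matrix.rank_mul_le_left _ _).trans (by simpa using Matrix.rank_le_card_width f.G)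
  · have h : f.L * B * f.R = 1 := by
      have h' : f.L * B * f.R = f.L * (f.G * f.H) * f.R := by rw [f.mul_eq]
      rw [h', Matrix.mul_assoc, Matrix.mul_assoc, f.right_inv, Matrix.mul_one, f.left_inv]
    calc k = (1 : Matrix (Fin k) (Fin k) F).rank := by simp [Matrix.rank_one]
      _ ≤ (f.L * B).rank := by rw [← h]; exact Matrix.rank_mul_le_left _ _
      _ ≤ B.rank := Matrix.rank_mul_le_right _ _

lemma mulVec_R (u' : Fin k → F) : B *ᵥ f.R *ᵥ u' = f.G *ᵥ u' := by
  have h : B * f.R = f.G * f.H * f.R := by rw [f.mul_eq]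
  rw [mulVec_mulVec, h, Matrix.mul_assoc, f.right_inv, Matrix.mul_one]

lemma vecMul_L (v' : Fin k → F) : (v' ᵥ* f.L) ᵥ* B = v' ᵥ* f.H := by
  have h : f.L * B = f.L * (f.G * f.H) := by rw [f.mul_eq]
  rw [vecMul_vecMul, h, ← Matrix.mul_assoc, f.left_inv, Matrix.one_mul]

lemma dotProduct_eq (u' v' : Fin k → F) : (v' ᵥ* f.L) ⬝ᵥ B *ᵥ f.R *ᵥ u' = v' ⬝ᵥ u' := by
  rw [f.mulVec_R, ← dotProduct_mulVec, f.L_G]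

lemma not_isCol {u : m → F} (h : ¬ f.IsCol u) (w : n → F) : u ≠ B *ᵥ w := by
  intro h'
  refine h ⟨f.H *ᵥ w, ?_⟩
  rw [h', mulVec_mulVec, f.mul_eq]

variable [DecidableEq n]

/-- `1 - RH` projects onto the kernel of `H`, and `v(1 - RH) = 0` would put `v` in the row space. -/
lemma exists_of_not_isRow {v : n → F} (h : ¬ f.IsRow v) : ∃ z, f.H *ᵥ z = 0 ∧ v ⬝ᵥ z = 1 := by
  have h1 : v - (v ᵥ* f.R) ᵥ* f.H ≠ 0 := fun h' => h ⟨_, sub_eq_zero.mp h'⟩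
  obtain ⟨j, hj⟩ := Function.ne_iff.mp h1
  have hz : f.H *ᵥ ((1 - f.R * f.H) *ᵥ Pi.single j 1) = 0 := by
    rw [mulVec_mulVec, Matrix.mul_sub, Matrix.mul_one, ← Matrix.mul_assoc, f.right_inv,
      Matrix.one_mul, sub_self, zero_mulVec]
  have hv : v ⬝ᵥ ((1 - f.R * f.H) *ᵥ Pi.single j 1) = (v - (v ᵥ* f.R) ᵥ* f.H) j := by
    rw [dotProduct_mulVec, vecMul_sub, vecMul_one, vecMul_vecMul]
    simp
  refine ⟨((v - (v ᵥ* f.R) ᵥ* f.H) j)⁻¹ • ((1 - f.R * f.H) *ᵥ Pi.single j 1), ?_, ?_⟩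
  · rw [mulVec_smul, hz, smul_zero]
  · rw [dotProduct_smul, hv, smul_eq_mul, inv_mul_cancel₀ hj]

lemma mulVec_eq_zero {z : n → F} (h : f.H *ᵥ z = 0) : B *ᵥ z = 0 := by
  conv_lhs => rw [← f.mul_eq]
  rw [← mulVec_mulVec, h, mulVec_zero]

/-- In the coordinates of the factorization `B` is the `k × k` identity, and `1 + u'v'ᵀ` is singular
exactly when `v' ⬝ u' = -1`. -/
lemma rank_add_of_dotProduct_eq {u' v' : Fin k → F} (h : v' ⬝ᵥ u' = -1) :
    (B + vecMulVec (f.G *ᵥ u') (v' ᵥ* f.H)).rank + 1 = k := by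
  rw [← f.dotProduct_eq] at h
  rw [← f.vecMul_L, ← f.mulVec_R, rank_add_vecMulVec_of_dotProduct_eq_neg_one h, f.rank_eq]

lemma rank_add_of_dotProduct_ne {u' v' : Fin k → F} (h : v' ⬝ᵥ u' ≠ -1) :
    (B + vecMulVec (f.G *ᵥ u') (v' ᵥ* f.H)).rank = k := by
  rw [← f.dotProduct_eq] at h
  rw [← f.vecMul_L, ← f.mulVec_R, rank_add_vecMulVec_of_dotProduct_ne_neg_one h, f.rank_eq]

lemma rank_add_of_isCol {u : m → F} {v : n → F} (hu : f.IsCol u) (hv : ¬ f.IsRow v) :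
    (B + vecMulVec u v).rank = k := by
  obtain ⟨z, hz, hvz⟩ := f.exists_of_not_isRow hv
  obtain ⟨u', rfl⟩ := hu
  refine le_antisymm ?_ ?_
  · rw [← f.mulVec_R]
    exact (rank_add_vecMulVec_mulVec_le _ _ _).trans f.rank_eq.le
  · exact f.rank_eq.ge.trans (rank_le_rank_add_vecMulVec_right (f.mulVec_eq_zero hz) hvz _)

variable [DecidableEq m]

lemma rank_add_of_isRow {u : m → F} {v : n → F} (hu : ¬ f.IsCol u) (hv : f.IsRow v) :
    (B + vecMulVec u v).rank = k := by
  rw [← Matrix.rank_transpose, Matrix.transpose_add, transpose_vecMulVec]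
  exact f.transpose.rank_add_of_isCol (f.transpose_isCol.mpr hv) (by rwa [f.transpose_isRow])

lemma rank_add_of_not {u : m → F} {v : n → F} (hu : ¬ f.IsCol u) (hv : ¬ f.IsRow v) :
    (B + vecMulVec u v).rank = k + 1 := by
  obtain ⟨z, hz, hvz⟩ := f.exists_of_not_isRow hv
  rw [rank_add_vecMulVec_of_not_mem (f.mulVec_eq_zero hz) hvz (f.not_isCol hu), f.rank_eq]

lemma rank_add_eq_add_one_iff {u : m → F} {v : n → F} :
    (B + vecMulVec u v).rank = k + 1 ↔ ¬ f.IsCol u ∧ ¬ f.IsRow v := by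
  by_cases hu : f.IsCol u <;> by_cases hv : f.IsRow v
  · simp only [hu, not_true, false_and, iff_false]
    obtain ⟨u', rfl⟩ := hu
    obtain ⟨v', rfl⟩ := hv
    by_cases h : v' ⬝ᵥ u' = -1
    · have := f.rank_add_of_dotProduct_eq h; omega
    · have := f.rank_add_of_dotProduct_ne h; omega
  · simp [hu, f.rank_add_of_isCol hu hv]
  · simp [hv, f.rank_add_of_isRow hu hv]
  · simp [hu, hv, f.rank_add_of_not hu hv]

lemma rank_add_add_one_eq_iff {u : m → F} {v : n → F} :
    (B + vecMulVec u v).rank + 1 = k ↔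
      ∃ u' v', u = f.G *ᵥ u' ∧ v = v' ᵥ* f.H ∧ v' ⬝ᵥ u' = -1 := by
  constructor
  · intro h
    by_cases hu : f.IsCol u <;> by_cases hv : f.IsRow v
    · obtain ⟨u', rfl⟩ := hu
      obtain ⟨v', rfl⟩ := hv
      refine ⟨u', v', rfl, rfl, ?_⟩
      by_contra hc
      have := f.rank_add_of_dotProduct_ne hc; omega
    · have := f.rank_add_of_isCol hu hv; omega
    · have := f.rank_add_of_isRow hu hv; omega
    · have := f.rank_add_of_not hu hv; omega
  · rintro ⟨u', v', rfl, rfl, h⟩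
    exact f.rank_add_of_dotProduct_eq h

end RankFactorization

/-! ### Counting common neighbours by their distance from `y`. -/

section Count

variable {F : Type*} [Field F] [Fintype F] [DecidableEq F] {m n : Type*} [Fintype m] [Fintype n]
  [DecidableEq m] [DecidableEq n]

/-- If `s` shared neither its column line with `u` nor its row line with `v`, subtracting `uvᵀ`
would raise its rank to two. So common neighbours come in two families, one keeping `v` and one
keeping `u`. -/
lemma eq_vecMulVec_of_rank_sub {s : Matrix m n F} {u : m → F} {v : n → F} (hu : u ≠ 0)
    (hv : v ≠ 0) (hs : s.rank = 1) (h : (s - vecMulVec u v).rank = 1) :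
    (∃ u₁, s = vecMulVec u₁ v) ∨ ∃ v₁, s = vecMulVec u v₁ := by
  obtain ⟨f⟩ := nonempty_rankFactorization s
  rw [hs] at f
  have hf : ∀ i j, s i j = f.G i 0 * f.H 0 j := by
    intro i j
    conv_lhs => rw [← f.mul_eq]
    simp [Matrix.mul_apply]
  by_contra! hc
  have h2 := f.rank_add_of_not (u := u) (v := -v) ?_ ?_
  · rw [vecMulVec_neg, ← sub_eq_add_neg] at h2
    omega
  · rintro ⟨u', hu'⟩
    have hu'' : ∀ i, u i = f.G i 0 * u' 0 := fun i => by
      rw [hu']; simp [mulVec, dotProduct]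
    have h0 : u' 0 ≠ 0 := fun h0 => hu (funext fun i => by rw [hu'' i, h0]; simp)
    apply hc.2 ((u' 0)⁻¹ • fun j => f.H 0 j)
    ext i j
    simp only [hf, vecMulVec_apply, hu'', Pi.smul_apply, smul_eq_mul]
    field_simp
  · rintro ⟨v', hv'⟩
    have hv'' : ∀ j, v j = -(v' 0 * f.H 0 j) := fun j => by
      have := congrFun hv' j
      simp only [Pi.neg_apply, vecMul, dotProduct, Finset.univ_unique, Fin.default_eq_zero,
        Finset.sum_singleton] at this
      rw [← this, neg_neg]
    have h0 : v' 0 ≠ 0 := fun h0 => hv (funext fun i => by rw [hv'' i, h0]; simp)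
    apply hc.1 (-(v' 0)⁻¹ • fun i => f.G i 0)
    ext i j
    simp only [hf, vecMulVec_apply, hv'', Pi.smul_apply, smul_eq_mul]
    field_simp

/-- The rank one matrices `s` with `s - r` of rank one and `B + s` of rank `l`. -/
noncomputable def common (B r : Matrix m n F) (l : ℕ) : Finset (Matrix m n F) :=
  Finset.univ.filter fun s => s.rank = 1 ∧ (s - r).rank = 1 ∧ (B + s).rank = l

lemma mem_common {B r s : Matrix m n F} {l : ℕ} :
    s ∈ common B r l ↔ s.rank = 1 ∧ (s - r).rank = 1 ∧ (B + s).rank = l := by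
  simp [common]

lemma card_common_transpose (B r : Matrix m n F) (l : ℕ) :
    (common Bᵀ rᵀ l).card = (common B r l).card := by
  refine Finset.card_bij (fun s _ => sᵀ) ?_ ?_ ?_
  · intro s hs
    rw [mem_common] at hs ⊢
    rw [← Matrix.rank_transpose s, ← Matrix.rank_transpose (s - rᵀ),
      ← Matrix.rank_transpose (Bᵀ + s)] at hs
    simpa only [Matrix.transpose_sub, Matrix.transpose_add, Matrix.transpose_transpose] using hs
  · intro s _ t _ h
    exact Matrix.transpose_injective h
  · intro s hs
    refine ⟨sᵀ, ?_, by simp⟩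
    rw [mem_common] at hs ⊢
    rw [← Matrix.transpose_sub, ← Matrix.transpose_add]
    simpa only [Matrix.rank_transpose] using hs

lemma vecMulVec_left_injective {v : n → F} (hv : v ≠ 0) :
    Function.Injective fun u : m → F => vecMulVec u v := by
  intro u u' h
  have h' : vecMulVec (u - u') v = 0 := by
    rw [sub_vecMulVec]; exact sub_eq_zero.mpr h
  exact sub_eq_zero.mp ((vecMulVec_eq_zero_iff.mp h').resolve_right hv)

lemma vecMulVec_right_injective {u : m → F} (hu : u ≠ 0) :
    Function.Injective fun v : n → F => vecMulVec u v := by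
  intro v v' h
  have h' : vecMulVec u (v - v') = 0 := by
    rw [vecMulVec_sub]; exact sub_eq_zero.mpr h
  exact sub_eq_zero.mp ((vecMulVec_eq_zero_iff.mp h').resolve_left hu)

lemma mem_common_vecMulVec {B s : Matrix m n F} {l : ℕ} {u : m → F} {v : n → F} (hu : u ≠ 0)
    (hv : v ≠ 0) : s ∈ common B (vecMulVec u v) l ↔
      (∃ u₁, u₁ ≠ 0 ∧ u₁ ≠ u ∧ (B + vecMulVec u₁ v).rank = l ∧ s = vecMulVec u₁ v) ∨
      (∃ v₁, v₁ ≠ 0 ∧ v₁ ≠ v ∧ (B + vecMulVec u v₁).rank = l ∧ s = vecMulVec u v₁) := by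
  rw [mem_common]
  constructor
  · rintro ⟨h1, h2, h3⟩
    rcases eq_vecMulVec_of_rank_sub hu hv h1 h2 with ⟨u₁, rfl⟩ | ⟨v₁, rfl⟩
    · refine Or.inl ⟨u₁, ?_, ?_, h3, rfl⟩
      · rintro rfl; simp at h1
      · rintro rfl; simp at h2
    · refine Or.inr ⟨v₁, ?_, ?_, h3, rfl⟩
      · rintro rfl
        rw [vecMulVec_eq_zero_iff.mpr (Or.inr rfl), Matrix.rank_zero] at h1
        exact zero_ne_one h1
      · rintro rfl; simp at h2
  · rintro (⟨u₁, h1, h2, h3, rfl⟩ | ⟨v₁, h1, h2, h3, rfl⟩)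
    · refine ⟨rank_vecMulVec_eq_one h1 hv, ?_, h3⟩
      rw [← sub_vecMulVec]
      exact rank_vecMulVec_eq_one (sub_ne_zero.mpr h2) hv
    · refine ⟨rank_vecMulVec_eq_one hu h1, ?_, h3⟩
      rw [← vecMulVec_sub]
      exact rank_vecMulVec_eq_one hu (sub_ne_zero.mpr h2)

lemma card_dotProduct_eq {v : n → F} (hv : v ≠ 0) (c : F) :
    (Finset.univ.filter fun u : n → F => v ⬝ᵥ u = c).card =
      Fintype.card F ^ (Fintype.card n - 1) := by
  have h0 : (Finset.univ.filter fun u : n → F => v ⬝ᵥ u = 0).card =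
      Fintype.card F ^ (Fintype.card n - 1) := by
    have h1 : (vecMulVec (fun _ : Fin 1 => (1 : F)) v).rank = 1 :=
      rank_vecMulVec_eq_one (fun h => one_ne_zero (congrFun h 0)) hv
    rw [← h1, ← card_mulVec_eq_zero]
    congr 1
    ext u
    simp only [Finset.mem_filter, Finset.mem_univ, true_and, vecMulVec_mulVec]
    constructor
    · intro h; rw [h]; simp
    · intro h; simpa using congrFun h 0
  obtain ⟨j, hj⟩ := Function.ne_iff.mp hv
  simp only [Pi.zero_apply] at hj
  rw [← h0]
  refine Finset.card_bij' (fun u _ => u - Pi.single j (c / v j))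
    (fun u _ => u + Pi.single j (c / v j)) ?_ ?_ ?_ ?_
  · intro u hu
    simp only [Finset.mem_filter, Finset.mem_univ, true_and] at hu ⊢
    rw [dotProduct_sub, hu, dotProduct_single]
    field_simp
    ring
  · intro u hu
    simp only [Finset.mem_filter, Finset.mem_univ, true_and] at hu ⊢
    rw [dotProduct_add, hu, dotProduct_single]
    field_simp
    ring
  · intro u _; simp
  · intro u _; simp

namespace RankFactorization

variable {B : Matrix m n F} {k : ℕ} (f : RankFactorization B k)

/-- Each of the two families is an affine hyperplane of `q ^ (k - 1)` points; `h` ensures that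
neither contains `uvᵀ` itself. They overlap in one matrix unless `v' ⬝ u' = 0`, which is what
separates `O₂` from `O₃`. -/
lemma card_common_sub_of_mem {u' v' : Fin k → F} (hu : u' ≠ 0) (hv : v' ≠ 0)
    (h : v' ⬝ᵥ u' ≠ -1) :
    (common B (vecMulVec (f.G *ᵥ u') (v' ᵥ* f.H)) (k - 1)).card =
      if v' ⬝ᵥ u' = 0 then 2 * Fintype.card F ^ (k - 1) else 2 * Fintype.card F ^ (k - 1) - 1 := by
  have hk : 0 < k := by
    rcases Nat.eq_zero_or_pos k with rfl | hk
    · exact absurd (Subsingleton.elim _ _) hu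
    · exact hk
  have hGu : f.G *ᵥ u' ≠ 0 := fun h0 => hu (f.G_injective (by simpa using h0))
  have hvH : v' ᵥ* f.H ≠ 0 := fun h0 => hv (f.H_injective (by simpa using h0))
  set S₁ := (Finset.univ.filter fun w : Fin k → F => v' ⬝ᵥ w = -1).image
    fun w => vecMulVec (f.G *ᵥ w) (v' ᵥ* f.H) with hS₁
  set S₂ := (Finset.univ.filter fun w : Fin k → F => u' ⬝ᵥ w = -1).image
    fun w => vecMulVec (f.G *ᵥ u') (w ᵥ* f.H) with hS₂
  have hS : common B (vecMulVec (f.G *ᵥ u') (v' ᵥ* f.H)) (k - 1) = S₁ ∪ S₂ := by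
    ext s
    have hl : ∀ r : ℕ, r = k - 1 ↔ r + 1 = k := fun r => by omega
    rw [mem_common_vecMulVec hGu hvH, Finset.mem_union, hS₁, hS₂, Finset.mem_image,
      Finset.mem_image]
    simp only [hl, f.rank_add_add_one_eq_iff, Finset.mem_filter, Finset.mem_univ, true_and]
    refine or_congr ⟨?_, ?_⟩ ⟨?_, ?_⟩
    · rintro ⟨u₁, -, -, ⟨w, v'', rfl, h1, h2⟩, rfl⟩
      obtain rfl := f.H_injective h1
      exact ⟨w, h2, rfl⟩
    · rintro ⟨w, hw, rfl⟩
      refine ⟨_, ?_, ?_, ⟨w, v', rfl, rfl, hw⟩, rfl⟩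
      · intro h0
        rw [f.G_injective (a₁ := w) (a₂ := 0) (by simpa using h0)] at hw
        simp at hw
      · intro h0
        obtain rfl := f.G_injective h0
        exact h hw
    · rintro ⟨v₁, -, -, ⟨u'', w, h1, rfl, h2⟩, rfl⟩
      obtain rfl := f.G_injective h1
      exact ⟨w, by rwa [dotProduct_comm], rfl⟩
    · rintro ⟨w, hw, rfl⟩
      rw [dotProduct_comm] at hw
      refine ⟨_, ?_, ?_, ⟨u', w, rfl, rfl, hw⟩, rfl⟩
      · intro h0
        rw [f.H_injective (a₁ := w) (a₂ := 0) (by simpa using h0)] at hw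
        simp at hw
      · intro h0
        obtain rfl := f.H_injective h0
        exact h hw
  have hc1 : S₁.card = Fintype.card F ^ (k - 1) := by
    rw [hS₁, Finset.card_image_of_injective (f := fun w => vecMulVec (f.G *ᵥ w) (v' ᵥ* f.H)) _
      ((vecMulVec_left_injective hvH).comp f.G_injective), card_dotProduct_eq hv, Fintype.card_fin]
  have hc2 : S₂.card = Fintype.card F ^ (k - 1) := by
    rw [hS₂, Finset.card_image_of_injective (f := fun w => vecMulVec (f.G *ᵥ u') (w ᵥ* f.H)) _
      ((vecMulVec_right_injective hGu).comp f.H_injective), card_dotProduct_eq hu,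
      Fintype.card_fin]
  -- A matrix in both families is a multiple of `uvᵀ`, and pairing to `-1` fixes the scalar as `-(v'
  -- ⬝ u')⁻¹`.
  have hint : ∀ s, s ∈ S₁ ∩ S₂ ↔ v' ⬝ᵥ u' ≠ 0 ∧
      s = vecMulVec (f.G *ᵥ (-(v' ⬝ᵥ u')⁻¹ • u')) (v' ᵥ* f.H) := by
    intro s
    rw [Finset.mem_inter, hS₁, hS₂, Finset.mem_image, Finset.mem_image]
    simp only [Finset.mem_filter, Finset.mem_univ, true_and]
    constructor
    · rintro ⟨⟨w, hw, rfl⟩, ⟨w', hw', h'⟩⟩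
      obtain ⟨c, hc1, hc2⟩ :=
        (vecMulVec_eq_iff (u' := f.G *ᵥ u') (v' := w' ᵥ* f.H) (u := f.G *ᵥ w)
          (v := v' ᵥ* f.H) (fun h0 => by
            rw [f.G_injective (a₁ := w) (a₂ := 0) (by simpa using h0)] at hw
            simp at hw) hvH).mp h'
      rw [← mulVec_smul] at hc1
      have h1 : u' = (c : F) • w := f.G_injective hc1
      rw [h1, dotProduct_smul, hw]
      refine ⟨by simp, ?_⟩
      congr 2
      rw [smul_smul]
      simp
    · rintro ⟨h0, rfl⟩
      refine ⟨⟨_, ?_, rfl⟩, ⟨-(v' ⬝ᵥ u')⁻¹ • v', ?_, ?_⟩⟩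
      · rw [dotProduct_smul]; simp [h0]
      · rw [dotProduct_smul, dotProduct_comm u' v']; simp [h0]
      · rw [mulVec_smul, smul_vecMul, vecMulVec_smul, smul_vecMulVec]
  have hcard := Finset.card_union_add_card_inter S₁ S₂
  rw [hS]
  split_ifs with h0
  · have : S₁ ∩ S₂ = ∅ := by
      ext s; rw [hint]; simp [h0]
    rw [this, Finset.card_empty] at hcard
    omega
  · have : S₁ ∩ S₂ = {vecMulVec (f.G *ᵥ (-(v' ⬝ᵥ u')⁻¹ • u')) (v' ᵥ* f.H)} := by
      ext s; rw [hint]; simp [h0]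
    rw [this, Finset.card_singleton] at hcard
    omega

lemma card_common_add_of_mem {u' v' : Fin k → F} (hu : u' ≠ 0) (hv : v' ≠ 0) :
    (common B (vecMulVec (f.G *ᵥ u') (v' ᵥ* f.H)) (k + 1)).card = 0 := by
  have hGu : f.G *ᵥ u' ≠ 0 := fun h0 => hu (f.G_injective (by simpa using h0))
  have hvH : v' ᵥ* f.H ≠ 0 := fun h0 => hv (f.H_injective (by simpa using h0))
  rw [Finset.card_eq_zero, Finset.eq_empty_iff_forall_notMem]
  intro s
  rw [mem_common_vecMulVec hGu hvH]
  simp only [f.rank_add_eq_add_one_iff]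
  rintro (⟨_, -, -, ⟨-, h⟩, -⟩ | ⟨_, -, -, ⟨h, -⟩, -⟩)
  · exact h ⟨_, rfl⟩
  · exact h ⟨_, rfl⟩

/-- Lowering the rank needs a row vector in the row space, so only the family keeping `u`
contributes. -/
lemma card_common_sub_of_isCol {u : m → F} {v : n → F} (hu0 : u ≠ 0) (hu : f.IsCol u)
    (hv : ¬ f.IsRow v) :
    (common B (vecMulVec u v) (k - 1)).card = Fintype.card F ^ (k - 1) := by
  obtain ⟨u', rfl⟩ := hu
  have hu' : u' ≠ 0 := by rintro rfl; simp at hu0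
  have hv0 : v ≠ 0 := by rintro rfl; exact hv ⟨0, by simp⟩
  have hk : 0 < k := by
    rcases Nat.eq_zero_or_pos k with rfl | hk
    · exact absurd (Subsingleton.elim _ _) hu'
    · exact hk
  have hS : common B (vecMulVec (f.G *ᵥ u') v) (k - 1) =
      (Finset.univ.filter fun w : Fin k → F => u' ⬝ᵥ w = -1).image
        fun w => vecMulVec (f.G *ᵥ u') (w ᵥ* f.H) := by
    ext s
    have hl : ∀ r : ℕ, r = k - 1 ↔ r + 1 = k := fun r => by omega
    rw [mem_common_vecMulVec hu0 hv0, Finset.mem_image]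
    simp only [hl, f.rank_add_add_one_eq_iff, Finset.mem_filter, Finset.mem_univ, true_and]
    constructor
    · rintro (⟨u₁, -, -, ⟨w, v'', rfl, h1, h2⟩, rfl⟩ | ⟨v₁, -, -, ⟨u'', w, h1, rfl, h2⟩, rfl⟩)
      · exact absurd ⟨_, h1⟩ hv
      · obtain rfl := f.G_injective h1
        exact ⟨w, by rwa [dotProduct_comm], rfl⟩
    · rintro ⟨w, hw, rfl⟩
      rw [dotProduct_comm] at hw
      refine Or.inr ⟨_, ?_, ?_, ⟨u', w, rfl, rfl, hw⟩, rfl⟩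
      · intro h0
        rw [f.H_injective (a₁ := w) (a₂ := 0) (by simpa using h0)] at hw
        simp at hw
      · intro h0
        exact hv ⟨_, h0.symm⟩
  rw [hS, Finset.card_image_of_injective (f := fun w => vecMulVec (f.G *ᵥ u') (w ᵥ* f.H)) _
      ((vecMulVec_right_injective hu0).comp f.H_injective), card_dotProduct_eq hu',
      Fintype.card_fin]

lemma card_not_isCol [DecidablePred f.IsCol] :
    (Finset.univ.filter fun u => ¬ f.IsCol u).card =
      Fintype.card F ^ Fintype.card m - Fintype.card F ^ k := by
  have h1 : (Finset.univ.filter fun u => f.IsCol u).card = Fintype.card F ^ k := by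
    have : (Finset.univ.filter fun u => f.IsCol u) = Finset.univ.image fun u' => f.G *ᵥ u' := by
      ext u
      rw [Finset.mem_filter, Finset.mem_image]
      simp [IsCol, eq_comm]
    rw [this, Finset.card_image_of_injective _ f.G_injective]
    simp
  have h2 := Finset.card_filter_add_card_filter_not (s := Finset.univ) (p := fun u => f.IsCol u)
  rw [h1, Finset.card_univ, Fintype.card_fun] at h2
  omega

/-- Raising the rank needs a column vector outside the column space, so only the family keeping `v`
contributes. -/
lemma card_common_add_of_isCol {u : m → F} {v : n → F} (hu0 : u ≠ 0) (hu : f.IsCol u)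
    (hv : ¬ f.IsRow v) : (common B (vecMulVec u v) (k + 1)).card =
      Fintype.card F ^ Fintype.card m - Fintype.card F ^ k := by
  classical
  have hv0 : v ≠ 0 := by rintro rfl; exact hv ⟨0, by simp⟩
  rw [← f.card_not_isCol, ← Finset.card_image_of_injective _ (vecMulVec_left_injective hv0)]
  congr 1
  ext s
  rw [mem_common_vecMulVec hu0 hv0, Finset.mem_image]
  simp only [f.rank_add_eq_add_one_iff, Finset.mem_filter, Finset.mem_univ, true_and]
  constructor
  · rintro (⟨u₁, -, -, ⟨h, -⟩, rfl⟩ | ⟨v₁, -, -, ⟨h, -⟩, rfl⟩)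
    · exact ⟨_, h, rfl⟩
    · exact absurd hu h
  · rintro ⟨w, hw, rfl⟩
    refine Or.inl ⟨w, ?_, ?_, ⟨hw, hv⟩, rfl⟩
    · rintro rfl; exact hw ⟨0, by simp⟩
    · rintro rfl; exact hw hu

lemma card_common_sub_of_isRow {u : m → F} {v : n → F} (hv0 : v ≠ 0) (hu : ¬ f.IsCol u)
    (hv : f.IsRow v) :
    (common B (vecMulVec u v) (k - 1)).card = Fintype.card F ^ (k - 1) := by
  rw [← card_common_transpose, transpose_vecMulVec]
  exact f.transpose.card_common_sub_of_isCol hv0 (f.transpose_isCol.mpr hv)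
    (by rwa [f.transpose_isRow])

lemma card_common_add_of_isRow {u : m → F} {v : n → F} (hv0 : v ≠ 0) (hu : ¬ f.IsCol u)
    (hv : f.IsRow v) : (common B (vecMulVec u v) (k + 1)).card =
      Fintype.card F ^ Fintype.card n - Fintype.card F ^ k := by
  rw [← card_common_transpose, transpose_vecMulVec]
  exact f.transpose.card_common_add_of_isCol hv0 (f.transpose_isCol.mpr hv)
    (by rwa [f.transpose_isRow])

end RankFactorization

end Count

/-! ### The parts `Oᵢ` as the six classes of rank one matrices. -/

section Parts

variable {F : Type*} [Field F] [Fintype F] [DecidableEq F]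

namespace RankFactorization

variable {m n : Type*} [Fintype m] [Fintype n] {B : Matrix m n F} {k : ℕ}
  (f : RankFactorization B k)

open Classical in
/-- The index of the orbit of the rank one matrix `uvᵀ`. -/
noncomputable def kind (u : m → F) (v : n → F) : Fin 6 :=
  if f.IsCol u then
    if f.IsRow v then
      if (v ᵥ* f.R) ⬝ᵥ (f.L *ᵥ u) = -1 then 0
      else if (v ᵥ* f.R) ⬝ᵥ (f.L *ᵥ u) = 0 then 1 else 2
    else 3
  else if f.IsRow v then 4 else 5

end RankFactorization

variable {D N : ℕ}

lemma localCount_add (x y r : Vertex F D N) (l : ℕ) :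
    localCount x y (x + r) l = (common (x - y) r l).card := by
  refine Finset.card_bij' (fun w _ => w - x) (fun s _ => s + x) ?_ ?_ ?_ ?_
  · intro w hw
    simp only [Finset.mem_inter, mem_sphere] at hw
    rw [mem_common, show w - x - r = w - (x + r) by abel, show x - y + (w - x) = w - y by abel]
    tauto
  · intro s hs
    rw [mem_common] at hs
    simp only [Finset.mem_inter, mem_sphere]
    rw [show s + x - (x + r) = s - r by abel, show s + x - y = x - y + s by abel,
      add_sub_cancel_right]
    tauto
  · intro w _; simp
  · intro w _; simp

lemma mem_middlePart {x y r : Vertex F D N} {a b : ℕ} (hr : r.rank = 1) :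
    x + r ∈ middlePart x y a b ↔ (x - y + r).rank = (x - y).rank ∧
      (common (x - y) r ((x - y).rank - 1)).card = a ∧
      (common (x - y) r ((x - y).rank + 1)).card = b := by
  rw [middlePart, Finset.mem_filter, Finset.mem_inter, mem_sphere, mem_sphere, localCount_add,
    localCount_add, graph_dist, add_sub_cancel_left, show x + r - y = x - y + r by abel]
  tauto

/-- The six kinds have different distances or counts: `k < D` makes `q ^ D - q ^ k` nonzero, and `D
< N - D` tells the column case from the row case. -/
lemma mem_part_iff {x y : Vertex F D N} {k : ℕ} (f : RankFactorization (x - y) k) (hk : 0 < k)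
    (hkD : k < D) (hN : D < N - D) {u : Fin D → F} {v : Fin (N - D) → F} (hu : u ≠ 0)
    (hv : v ≠ 0) (i : Fin 6) : x + vecMulVec u v ∈ part x y i ↔ f.kind u v = i := by
  have hr := rank_vecMulVec_eq_one hu hv
  have hq : 1 < Fintype.card F := Fintype.one_lt_card
  have h1 : Fintype.card F ^ k < Fintype.card F ^ D := Nat.pow_lt_pow_right hq hkD
  have h2 : Fintype.card F ^ D < Fintype.card F ^ (N - D) := Nat.pow_lt_pow_right hq hN
  have h3 : 0 < Fintype.card F ^ (k - 1) := by positivity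
  have hs : ∀ l, x + vecMulVec u v ∈ sphere (graph F D N) 1 x ∩ sphere (graph F D N) l y ↔
      (x - y + vecMulVec u v).rank = l := by
    intro l
    rw [Finset.mem_inter, mem_sphere, mem_sphere, add_sub_cancel_left,
      show x + vecMulVec u v - y = x - y + vecMulVec u v by abel]
    tauto
  have key : x + vecMulVec u v ∈ part x y i ↔
      (![(x - y + vecMulVec u v).rank = k - 1,
        (x - y + vecMulVec u v).rank = k ∧
          (common (x - y) (vecMulVec u v) (k - 1)).card = 2 * Fintype.card F ^ (k - 1) ∧
          (common (x - y) (vecMulVec u v) (k + 1)).card = 0,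
        (x - y + vecMulVec u v).rank = k ∧
          (common (x - y) (vecMulVec u v) (k - 1)).card = 2 * Fintype.card F ^ (k - 1) - 1 ∧
          (common (x - y) (vecMulVec u v) (k + 1)).card = 0,
        (x - y + vecMulVec u v).rank = k ∧
          (common (x - y) (vecMulVec u v) (k - 1)).card = Fintype.card F ^ (k - 1) ∧
          (common (x - y) (vecMulVec u v) (k + 1)).card =
            Fintype.card F ^ D - Fintype.card F ^ k,
        (x - y + vecMulVec u v).rank = k ∧
          (common (x - y) (vecMulVec u v) (k - 1)).card = Fintype.card F ^ (k - 1) ∧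
          (common (x - y) (vecMulVec u v) (k + 1)).card =
            Fintype.card F ^ (N - D) - Fintype.card F ^ k,
        (x - y + vecMulVec u v).rank = k + 1] : Fin 6 → Prop) i := by
    rw [part, graph_dist, f.rank_eq]
    fin_cases i
    · exact hs _
    · exact (mem_middlePart hr).trans (by rw [f.rank_eq]; rfl)
    · exact (mem_middlePart hr).trans (by rw [f.rank_eq]; rfl)
    · exact (mem_middlePart hr).trans (by rw [f.rank_eq]; rfl)
    · exact (mem_middlePart hr).trans (by rw [f.rank_eq]; rfl)
    · exact hs _
  rw [key, RankFactorization.kind]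
  clear key hs
  by_cases hc : f.IsCol u <;> by_cases hw : f.IsRow v
  · rw [if_pos hc, if_pos hw]
    obtain ⟨u', rfl⟩ := hc
    obtain ⟨v', rfl⟩ := hw
    have hu' : u' ≠ 0 := by rintro rfl; simp at hu
    have hv' : v' ≠ 0 := by rintro rfl; simp at hv
    rw [f.L_G, f.H_R]
    by_cases hb : v' ⬝ᵥ u' = -1
    · have hrank := f.rank_add_of_dotProduct_eq hb
      rw [if_pos hb, show (x - y + vecMulVec (f.G *ᵥ u') (v' ᵥ* f.H)).rank = k - 1 by omega]
      have e1 : k - 1 ≠ k := by omega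
      have e2 : k - 1 ≠ k + 1 := by omega
      fin_cases i <;> simp [e1, e2]
    · have hrank := f.rank_add_of_dotProduct_ne hb
      rw [if_neg hb, hrank, f.card_common_sub_of_mem hu' hv' hb, f.card_common_add_of_mem hu' hv']
      have e1 : k ≠ k - 1 := by omega
      have e2 : 0 ≠ Fintype.card F ^ D - Fintype.card F ^ k := by omega
      have e3 : 0 ≠ Fintype.card F ^ (N - D) - Fintype.card F ^ k := by omega
      have e4 : 2 * Fintype.card F ^ (k - 1) ≠ 2 * Fintype.card F ^ (k - 1) - 1 := by omega
      split_ifs <;> fin_cases i <;> simp [e1, e2, e3, e4, e4.symm]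
  · rw [if_pos hc, if_neg hw, f.rank_add_of_isCol hc hw, f.card_common_sub_of_isCol hu hc hw,
      f.card_common_add_of_isCol hu hc hw, Fintype.card_fin]
    have e1 : k ≠ k - 1 := by omega
    have e2 : Fintype.card F ^ D - Fintype.card F ^ k ≠ 0 := by omega
    have e3 : Fintype.card F ^ D - Fintype.card F ^ k ≠
      Fintype.card F ^ (N - D) - Fintype.card F ^ k := by omega
    fin_cases i <;> simp [e1, e2, e3]
  · rw [if_neg hc, if_pos hw, f.rank_add_of_isRow hc hw, f.card_common_sub_of_isRow hv hc hw,
      f.card_common_add_of_isRow hv hc hw, Fintype.card_fin]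
    have e1 : k ≠ k - 1 := by omega
    have e2 : Fintype.card F ^ (N - D) - Fintype.card F ^ k ≠ 0 := by omega
    have e3 : Fintype.card F ^ (N - D) - Fintype.card F ^ k ≠
      Fintype.card F ^ D - Fintype.card F ^ k := by omega
    fin_cases i <;> simp [e1, e2, e3]
  · rw [if_neg hc, if_neg hw, f.rank_add_of_not hc hw]
    have e1 : k + 1 ≠ k - 1 := by omega
    fin_cases i <;> simp [e1]

lemma part_subset (x y : Vertex F D N) (i : Fin 6) : part x y i ⊆ sphere (graph F D N) 1 x := by
  fin_cases i
  · exact Finset.inter_subset_left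
  · exact (Finset.filter_subset _ _).trans Finset.inter_subset_left
  · exact (Finset.filter_subset _ _).trans Finset.inter_subset_left
  · exact (Finset.filter_subset _ _).trans Finset.inter_subset_left
  · exact (Finset.filter_subset _ _).trans Finset.inter_subset_left
  · exact Finset.inter_subset_left

lemma part_subset_sphere (x y : Vertex F D N) (i : Fin 6) :
    part x y i ⊆ sphere (graph F D N) (partDist x y i) y := by
  fin_cases i
  · exact Finset.inter_subset_right
  · exact (Finset.filter_subset _ _).trans Finset.inter_subset_right
  · exact (Finset.filter_subset _ _).trans Finset.inter_subset_right
  · exact (Finset.filter_subset _ _).trans Finset.inter_subset_right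
  · exact (Finset.filter_subset _ _).trans Finset.inter_subset_right
  · exact Finset.inter_subset_right

/-- Sums over a part of the neighbourhood of `x` as sums over pairs of vectors. -/
lemma sum_part {x y : Vertex F D N} {k : ℕ} (f : RankFactorization (x - y) k) (hk : 0 < k)
    (hkD : k < D) (hN : D < N - D) (i : Fin 6) (g : Vertex F D N → ℂ) :
    (qr F - 1) * ∑ z ∈ part x y i, g (z - x) =
      ∑ p ∈ pairs (Fin D) (Fin (N - D)) F,
        if f.kind p.1 p.2 = i then g (vecMulVec p.1 p.2) else 0 := by
  have h1 : ∑ z ∈ part x y i, g (z - x) =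
      ∑ s ∈ Finset.univ.filter (fun s : Vertex F D N => s.rank = 1),
        if x + s ∈ part x y i then g s else 0 := by
    rw [← Finset.sum_filter]
    refine Finset.sum_bij' (fun z _ => z - x) (fun s _ => x + s) ?_ ?_ ?_ ?_ ?_
    · intro z hz
      have := mem_sphere.mp (part_subset x y i hz)
      simp [hz, this]
    · intro s hs
      exact (Finset.mem_filter.mp hs).2
    · intro z _; simp
    · intro z _; simp
    · intro z _; rfl
  rw [h1, ← sum_pairs]
  refine Finset.sum_congr rfl fun p hp => ?_
  rw [mem_pairs] at hp
  simp only [mem_part_iff f hk hkD hN hp.1 hp.2]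

end Parts

/-! ### Character sums over the parts. -/

section Sums

variable {F : Type*} [Field F] [Fintype F] [DecidableEq F]

section Hyperplane

variable {n : Type*} [Fintype n] [DecidableEq n]

/-- The matrix `t + baᵀ` is invertible unless `t = -(a ⬝ b)`, and then its kernel is the line
spanned by `b`. -/
lemma card_smul_add_of_ne_zero (a b : n → F) {t : F} (ht : t ≠ 0) :
    (Finset.univ.filter fun u : n → F => t • u + (a ⬝ᵥ u) • b = 0).card =
      if t = -(a ⬝ᵥ b) then Fintype.card F else 1 := by
  split_ifs with h
  · have hb : b ≠ 0 := by
      rintro rfl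
      simp at h
      exact ht h
    rw [← Finset.card_univ, ← Finset.card_image_of_injective _ (smul_left_injective F hb)]
    congr 1
    ext u
    simp only [Finset.mem_filter, Finset.mem_univ, true_and, Finset.mem_image]
    constructor
    · intro hu
      refine ⟨-(t⁻¹ * (a ⬝ᵥ u)), ?_⟩
      have h1 : t⁻¹ • (t • u + (a ⬝ᵥ u) • b) = 0 := by rw [hu, smul_zero]
      rw [smul_add, inv_smul_smul₀ ht, smul_smul] at h1
      rw [neg_smul]
      exact (eq_neg_of_add_eq_zero_left h1).symm
    · rintro ⟨c, rfl⟩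
      rw [dotProduct_smul, smul_smul, ← add_smul, h, smul_eq_mul]
      simp [mul_comm]
  · rw [Finset.card_eq_one]
    refine ⟨0, ?_⟩
    ext u
    simp only [Finset.mem_filter, Finset.mem_univ, true_and, Finset.mem_singleton]
    constructor
    · intro hu
      have h1 : (t + a ⬝ᵥ b) * (a ⬝ᵥ u) = 0 := by
        have := congrArg (fun w => a ⬝ᵥ w) hu
        simp only [dotProduct_add, dotProduct_smul, dotProduct_zero, smul_eq_mul] at this
        linear_combination this
      have h2 : a ⬝ᵥ u = 0 := (mul_eq_zero.mp h1).resolve_left fun h0 =>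
        h (eq_neg_of_add_eq_zero_left h0)
      rw [h2, zero_smul, add_zero] at hu
      exact (smul_eq_zero.mp hu).resolve_left ht
    · rintro rfl
      simp

/-- The number of `u` with `(a ⬝ᵥ u) • b = 0`. -/
noncomputable def degenerateCard (a b : n → F) : ℝ :=
  ((Finset.univ.filter fun u : n → F => (a ⬝ᵥ u) • b = 0).card : ℝ)

lemma degenerateCard_of_ne_zero {a b : n → F} (ha : a ≠ 0) (hb : b ≠ 0) :
    degenerateCard a b = (Fintype.card F : ℝ) ^ (Fintype.card n - 1) := by
  rw [degenerateCard, ← Nat.cast_pow, ← card_dotProduct_eq ha 0]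
  simp [hb]

/-- The condition `v ⬝ u = c` is detected by summing `χ(t (v ⬝ u - c))` over `t`; the sum over `v`
then forces `t u + (a ⬝ u) b = 0`, whose solutions `u` are counted for each `t`. -/
lemma sum_dotProduct_eq (a b : n → F) (c : F) :
    (qr F : ℂ) * ∑ u : n → F, ∑ v : n → F,
        (if v ⬝ᵥ u = c then chi F ((a ⬝ᵥ u) * (v ⬝ᵥ b)) else 0) =
      (qr F : ℂ) ^ Fintype.card n * ((if c = 0 then (qr F : ℂ) else 0) +
        (qr F - 1) * chi F ((a ⬝ᵥ b) * c) + degenerateCard a b - 1 -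
        (qr F - 1) * if a ⬝ᵥ b = 0 then 1 else 0) := by
  have h1 : ∀ u v : n → F, (qr F : ℂ) *
      (if v ⬝ᵥ u = c then chi F ((a ⬝ᵥ u) * (v ⬝ᵥ b)) else 0) =
      ∑ t, chi F (-(t * c)) * chi F (v ⬝ᵥ (t • u + (a ⬝ᵥ u) • b)) := by
    intro u v
    have : ∀ t, chi F (-(t * c)) * chi F (v ⬝ᵥ (t • u + (a ⬝ᵥ u) • b)) =
        chi F (t * (v ⬝ᵥ u - c)) * chi F ((a ⬝ᵥ u) * (v ⬝ᵥ b)) := by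
      intro t
      rw [← AddChar.map_add_eq_mul, ← AddChar.map_add_eq_mul]
      congr 1
      rw [dotProduct_add, dotProduct_smul, dotProduct_smul, smul_eq_mul, smul_eq_mul]
      ring
    rw [Finset.sum_congr rfl fun t _ => this t, ← Finset.sum_mul, sum_chi_mul]
    simp only [sub_eq_zero]
    split_ifs <;> simp
  -- The last summand corrects the generic count at `t = 0`, including the case `a ⬝ b = 0` in which
  -- the exceptional value of `t` is `0` itself.
  have h2 : ∀ t : F, ((Finset.univ.filter fun u : n → F =>
      t • u + (a ⬝ᵥ u) • b = 0).card : ℂ) = 1 + (qr F - 1) * (if t = -(a ⬝ᵥ b) then 1 else 0) +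
        if t = 0 then ((degenerateCard a b : ℂ) - 1 - (qr F - 1) * if a ⬝ᵥ b = 0 then 1 else 0)
          else 0 := by
    intro t
    by_cases ht : t = 0
    · subst ht
      simp only [zero_smul, zero_add, degenerateCard, zero_eq_neg, if_true]
      push_cast
      ring
    · rw [card_smul_add_of_ne_zero a b ht, if_neg ht]
      split_ifs <;> simp [qr]
  simp only [Finset.mul_sum, h1]
  have h3 : ∑ u : n → F, ∑ v : n → F, ∑ t : F,
      chi F (-(t * c)) * chi F (v ⬝ᵥ (t • u + (a ⬝ᵥ u) • b)) =
      ∑ t : F, chi F (-(t * c)) * ((qr F : ℂ) ^ Fintype.card n *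
        ((Finset.univ.filter fun u : n → F => t • u + (a ⬝ᵥ u) • b = 0).card : ℂ)) := by
    have : ∀ u : n → F, ∑ v : n → F, ∑ t : F,
        chi F (-(t * c)) * chi F (v ⬝ᵥ (t • u + (a ⬝ᵥ u) • b)) =
        ∑ t : F, chi F (-(t * c)) *
          if t • u + (a ⬝ᵥ u) • b = 0 then (qr F : ℂ) ^ Fintype.card n else 0 := by
      intro u
      rw [Finset.sum_comm]
      refine Finset.sum_congr rfl fun t _ => ?_
      rw [← Finset.mul_sum, sum_chi_dotProduct]
    rw [Finset.sum_congr rfl fun u _ => this u, Finset.sum_comm]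
    refine Finset.sum_congr rfl fun t _ => ?_
    rw [← Finset.mul_sum, ← Finset.sum_filter, Finset.sum_const, nsmul_eq_mul, mul_comm
      (Nat.cast _)]
  rw [h3]
  simp only [h2]
  have h4 : ∑ t, chi F (-(t * c)) = if c = 0 then (qr F : ℂ) else 0 := by
    have := sum_chi_mul (-c)
    simpa using this
  rw [← h4]
  have h5 : ∀ t, chi F (-(t * c)) * ((qr F : ℂ) ^ Fintype.card n *
      (1 + (qr F - 1) * (if t = -(a ⬝ᵥ b) then 1 else 0) +
        if t = 0 then ((degenerateCard a b : ℂ) - 1 - (qr F - 1) * if a ⬝ᵥ b = 0 then 1 else 0)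
          else 0)) = (qr F : ℂ) ^ Fintype.card n * (chi F (-(t * c)) +
        (if t = -(a ⬝ᵥ b) then (qr F - 1) * chi F (-(t * c)) else 0) +
        (if t = 0 then ((degenerateCard a b : ℂ) - 1 - (qr F - 1) * if a ⬝ᵥ b = 0 then 1 else 0) *
          chi F (-(t * c)) else 0)) := by
    intro t
    split_ifs <;> ring
  rw [Finset.sum_congr rfl fun t _ => h5 t, ← Finset.mul_sum, Finset.sum_add_distrib,
    Finset.sum_add_distrib, Finset.sum_ite_eq' , Finset.sum_ite_eq']
  simp only [Finset.mem_univ, if_true, zero_mul, neg_zero, AddChar.map_zero_eq_one, neg_mul,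
    neg_neg]
  ring

end Hyperplane

section Reindex

variable {m n : Type*} [Fintype m] [Fintype n] [DecidableEq m] [DecidableEq n]
  {B : Matrix m n F} {k : ℕ} (f : RankFactorization B k)

lemma RankFactorization.G_L {u : m → F} (h : f.IsCol u) : f.G *ᵥ f.L *ᵥ u = u := by
  obtain ⟨u', rfl⟩ := h
  rw [f.L_G]

lemma RankFactorization.R_H {v : n → F} (h : f.IsRow v) : (v ᵥ* f.R) ᵥ* f.H = v := by
  obtain ⟨v', rfl⟩ := h
  rw [f.H_R]

open Classical in
lemma sum_pairs_isCol_isRow (g : (m → F) → (n → F) → ℂ) :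
    ∑ p ∈ pairs m n F, (if f.IsCol p.1 ∧ f.IsRow p.2 then g p.1 p.2 else 0) =
      ∑ p ∈ pairs (Fin k) (Fin k) F, g (f.G *ᵥ p.1) (p.2 ᵥ* f.H) := by
  rw [← Finset.sum_filter]
  refine Finset.sum_bij' (fun p _ => (f.L *ᵥ p.1, p.2 ᵥ* f.R))
    (fun p _ => (f.G *ᵥ p.1, p.2 ᵥ* f.H)) ?_ ?_ ?_ ?_ ?_
  · intro p hp
    rw [Finset.mem_filter, mem_pairs] at hp
    rw [mem_pairs]
    refine ⟨fun h => hp.1.1 ?_, fun h => hp.1.2 ?_⟩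
    · rw [← f.G_L hp.2.1]; exact (congrArg _ h).trans (mulVec_zero _)
    · rw [← f.R_H hp.2.2]; exact (congrArg (· ᵥ* f.H) h).trans (zero_vecMul _)
  · intro p hp
    rw [mem_pairs] at hp
    rw [Finset.mem_filter, mem_pairs]
    refine ⟨⟨fun h => hp.1 (f.G_injective ?_), fun h => hp.2 (f.H_injective ?_)⟩,
      ⟨_, rfl⟩, ⟨_, rfl⟩⟩
    · simpa using h
    · simpa using h
  · intro p hp
    rw [Finset.mem_filter] at hp
    exact Prod.ext (f.G_L hp.2.1) (f.R_H hp.2.2)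
  · intro p hp
    exact Prod.ext (f.L_G _) (f.H_R _)
  · intro p hp
    rw [Finset.mem_filter] at hp
    simp only [f.G_L hp.2.1, f.R_H hp.2.2]

open Classical in
lemma sum_pairs_isCol (g : (m → F) → (n → F) → ℂ) :
    ∑ p ∈ pairs m n F, (if f.IsCol p.1 then g p.1 p.2 else 0) =
      ∑ p ∈ pairs (Fin k) n F, g (f.G *ᵥ p.1) p.2 := by
  rw [← Finset.sum_filter]
  refine Finset.sum_bij' (fun p _ => (f.L *ᵥ p.1, p.2))
    (fun p _ => (f.G *ᵥ p.1, p.2)) ?_ ?_ ?_ ?_ ?_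
  · intro p hp
    rw [Finset.mem_filter, mem_pairs] at hp
    rw [mem_pairs]
    refine ⟨fun h => hp.1.1 ?_, hp.1.2⟩
    rw [← f.G_L hp.2]; exact (congrArg _ h).trans (mulVec_zero _)
  · intro p hp
    rw [mem_pairs] at hp
    rw [Finset.mem_filter, mem_pairs]
    refine ⟨⟨fun h => hp.1 (f.G_injective ?_), hp.2⟩, ⟨_, rfl⟩⟩
    simpa using h
  · intro p hp
    rw [Finset.mem_filter] at hp
    exact Prod.ext (f.G_L hp.2) rfl
  · intro p hp
    exact Prod.ext (f.L_G _) rfl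
  · intro p hp
    rw [Finset.mem_filter] at hp
    simp only [f.G_L hp.2]

open Classical in
lemma sum_pairs_isRow (g : (m → F) → (n → F) → ℂ) :
    ∑ p ∈ pairs m n F, (if f.IsRow p.2 then g p.1 p.2 else 0) =
      ∑ p ∈ pairs m (Fin k) F, g p.1 (p.2 ᵥ* f.H) := by
  rw [← Finset.sum_filter]
  refine Finset.sum_bij' (fun p _ => (p.1, p.2 ᵥ* f.R))
    (fun p _ => (p.1, p.2 ᵥ* f.H)) ?_ ?_ ?_ ?_ ?_
  · intro p hp
    rw [Finset.mem_filter, mem_pairs] at hp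
    rw [mem_pairs]
    refine ⟨hp.1.1, fun h => hp.1.2 ?_⟩
    rw [← f.R_H hp.2]; exact (congrArg (· ᵥ* f.H) h).trans (zero_vecMul _)
  · intro p hp
    rw [mem_pairs] at hp
    rw [Finset.mem_filter, mem_pairs]
    refine ⟨⟨hp.1, fun h => hp.2 (f.H_injective ?_)⟩, ⟨_, rfl⟩⟩
    simpa using h
  · intro p hp
    rw [Finset.mem_filter] at hp
    exact Prod.ext rfl (f.R_H hp.2)
  · intro p hp
    exact Prod.ext rfl (f.H_R _)
  · intro p hp
    rw [Finset.mem_filter] at hp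
    simp only [f.R_H hp.2]

lemma dotProduct_vecMulVec_mulVec (a u : m → F) (b v : n → F) :
    a ⬝ᵥ vecMulVec u v *ᵥ b = (a ⬝ᵥ u) * (v ⬝ᵥ b) := by
  rw [vecMulVec_mulVec]
  simp [mul_comm]

lemma sum_pairs_chi (a : m → F) (b : n → F) :
    ∑ p ∈ pairs m n F, chi F ((a ⬝ᵥ p.1) * (p.2 ⬝ᵥ b)) =
      (qr F - 1) * theta F m n (vecMulVec a b).rank := by
  rw [← sum_rank_one_chi, ← sum_pairs]
  refine Finset.sum_congr rfl fun p _ => ?_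
  rw [pairing_comm, pairing_vecMulVec, dotProduct_vecMulVec_mulVec]

end Reindex

section Kind

variable {m n : Type*} [Fintype m] [Fintype n] {B : Matrix m n F} {k : ℕ}
  (f : RankFactorization B k) (u : m → F) (v : n → F) (c : ℂ)

open Classical in
-- Unions of kinds without a condition on `v' ⬝ u'` are products of a set of `u` and a set of `v`;
-- their character sums reduce to `theta` of a smaller matrix space.
lemma RankFactorization.ite_kind_mem :
    (if f.kind u v = 0 then c else 0) + (if f.kind u v = 1 then c else 0) +
      (if f.kind u v = 2 then c else 0) = if f.IsCol u ∧ f.IsRow v then c else 0 := by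
  rw [RankFactorization.kind]
  split_ifs <;> simp_all

open Classical in
lemma RankFactorization.ite_kind_isCol :
    (if f.kind u v = 0 then c else 0) + (if f.kind u v = 1 then c else 0) +
      (if f.kind u v = 2 then c else 0) + (if f.kind u v = 3 then c else 0) =
      if f.IsCol u then c else 0 := by
  rw [RankFactorization.kind]
  split_ifs <;> simp_all

open Classical in
lemma RankFactorization.ite_kind_isRow :
    (if f.kind u v = 0 then c else 0) + (if f.kind u v = 1 then c else 0) +
      (if f.kind u v = 2 then c else 0) + (if f.kind u v = 4 then c else 0) =
      if f.IsRow v then c else 0 := by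
  rw [RankFactorization.kind]
  split_ifs <;> simp_all

open Classical in
lemma RankFactorization.ite_kind_zero : (if f.kind u v = 0 then c else 0) =
    if f.IsCol u ∧ f.IsRow v then
      if (v ᵥ* f.R) ⬝ᵥ (f.L *ᵥ u) = -1 then c else 0 else 0 := by
  rw [RankFactorization.kind]
  split_ifs <;> simp_all

open Classical in
lemma RankFactorization.ite_kind_one : (if f.kind u v = 1 then c else 0) =
    if f.IsCol u ∧ f.IsRow v then
      if (v ᵥ* f.R) ⬝ᵥ (f.L *ᵥ u) = 0 then c else 0 else 0 := by
  rw [RankFactorization.kind]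
  split_ifs <;> simp_all

end Kind

section PartSum

variable {D N : ℕ} (x y : Vertex F D N)

/-- The character sum over the part with index `i`, translated by `x`. -/
noncomputable def partSum (i : Fin 6) (a : Fin D → F) (b : Fin (N - D) → F) : ℂ :=
  ∑ z ∈ part x y i, chi F (a ⬝ᵥ (z - x) *ᵥ b)

variable {x y} {k : ℕ} (f : RankFactorization (x - y) k)

lemma qr_sub_one_ne_zero : (qr F : ℂ) - 1 ≠ 0 := by
  have := one_lt_qr F
  exact_mod_cast sub_ne_zero.mpr this.ne'

lemma partSum_mul (hk : 0 < k) (hkD : k < D) (hN : D < N - D) (a : Fin D → F)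
    (b : Fin (N - D) → F) (i : Fin 6) : (qr F - 1) * partSum x y i a b =
    ∑ p ∈ pairs (Fin D) (Fin (N - D)) F,
      if f.kind p.1 p.2 = i then chi F ((a ⬝ᵥ p.1) * (p.2 ⬝ᵥ b)) else 0 := by
  rw [partSum, sum_part f hk hkD hN i fun s => chi F (a ⬝ᵥ s *ᵥ b)]
  simp only [dotProduct_vecMulVec_mulVec]

lemma partSum_mem (hk : 0 < k) (hkD : k < D) (hN : D < N - D) (a : Fin D → F)
    (b : Fin (N - D) → F) :
    partSum x y 0 a b + partSum x y 1 a b + partSum x y 2 a b =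
      theta F (Fin k) (Fin k) (vecMulVec (a ᵥ* f.G) (f.H *ᵥ b)).rank := by
  classical
  apply mul_left_cancel₀ (qr_sub_one_ne_zero (F := F))
  rw [← sum_pairs_chi, mul_add, mul_add]
  simp only [← dotProduct_mulVec a f.G, dotProduct_mulVec _ f.H b]
  rw [← sum_pairs_isCol_isRow f fun u v => chi F ((a ⬝ᵥ u) * (v ⬝ᵥ b))]
  simp only [partSum_mul f hk hkD hN, ← Finset.sum_add_distrib]
  refine Finset.sum_congr rfl fun p _ => ?_
  exact f.ite_kind_mem _ _ _

lemma partSum_isCol (hk : 0 < k) (hkD : k < D) (hN : D < N - D) (a : Fin D → F)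
    (b : Fin (N - D) → F) :
    partSum x y 0 a b + partSum x y 1 a b + partSum x y 2 a b + partSum x y 3 a b =
      theta F (Fin k) (Fin (N - D)) (vecMulVec (a ᵥ* f.G) b).rank := by
  classical
  apply mul_left_cancel₀ (qr_sub_one_ne_zero (F := F))
  rw [← sum_pairs_chi, mul_add, mul_add, mul_add]
  simp only [← dotProduct_mulVec a f.G]
  rw [← sum_pairs_isCol f fun u v => chi F ((a ⬝ᵥ u) * (v ⬝ᵥ b))]
  simp only [partSum_mul f hk hkD hN, ← Finset.sum_add_distrib]
  refine Finset.sum_congr rfl fun p _ => ?_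
  exact f.ite_kind_isCol _ _ _

lemma partSum_isRow (hk : 0 < k) (hkD : k < D) (hN : D < N - D) (a : Fin D → F)
    (b : Fin (N - D) → F) :
    partSum x y 0 a b + partSum x y 1 a b + partSum x y 2 a b + partSum x y 4 a b =
      theta F (Fin D) (Fin k) (vecMulVec a (f.H *ᵥ b)).rank := by
  classical
  apply mul_left_cancel₀ (qr_sub_one_ne_zero (F := F))
  rw [← sum_pairs_chi, mul_add, mul_add, mul_add]
  simp only [dotProduct_mulVec _ f.H b]
  rw [← sum_pairs_isRow f fun u v => chi F ((a ⬝ᵥ u) * (v ⬝ᵥ b))]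
  simp only [partSum_mul f hk hkD hN, ← Finset.sum_add_distrib]
  refine Finset.sum_congr rfl fun p _ => ?_
  exact f.ite_kind_isRow _ _ _

lemma sum_partSum (f : RankFactorization (x - y) k) (hk : 0 < k) (hkD : k < D) (hN : D < N - D) (a : Fin D → F)
    (b : Fin (N - D) → F) :
    ∑ i, partSum x y i a b = theta F (Fin D) (Fin (N - D)) (vecMulVec a b).rank := by
  apply mul_left_cancel₀ (qr_sub_one_ne_zero (F := F))
  rw [← sum_pairs_chi, Finset.mul_sum]
  simp only [partSum_mul f hk hkD hN]
  rw [Finset.sum_comm]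
  refine Finset.sum_congr rfl fun p _ => ?_
  rw [Finset.sum_ite_eq]
  simp

lemma partSum_zero_eq (hk : 0 < k) (hkD : k < D) (hN : D < N - D) (a : Fin D → F)
    (b : Fin (N - D) → F) : (qr F - 1) * partSum x y 0 a b =
      ∑ u : Fin k → F, ∑ v : Fin k → F,
        if v ⬝ᵥ u = -1 then chi F (((a ᵥ* f.G) ⬝ᵥ u) * (v ⬝ᵥ f.H *ᵥ b)) else 0 := by
  classical
  have h1 := sum_pairs_eq fun u v : Fin k → F =>
    if v ⬝ᵥ u = -1 then chi F (((a ᵥ* f.G) ⬝ᵥ u) * (v ⬝ᵥ f.H *ᵥ b)) else 0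
  have h0 : (0 : F) ≠ -1 := by simp
  simp only [zero_dotProduct, dotProduct_zero, h0, if_false, Finset.sum_const_zero, sub_zero,
    add_zero] at h1
  rw [← h1, partSum_mul f hk hkD hN]
  have h2 := sum_pairs_isCol_isRow f fun (u : Fin D → F) (v : Fin (N - D) → F) =>
    if (v ᵥ* f.R) ⬝ᵥ (f.L *ᵥ u) = -1 then chi F ((a ⬝ᵥ u) * (v ⬝ᵥ b)) else 0
  simp only [f.L_G, f.H_R] at h2
  simp only [← dotProduct_mulVec a f.G, dotProduct_mulVec _ f.H b]
  rw [← h2]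
  refine Finset.sum_congr rfl fun p _ => ?_
  exact f.ite_kind_zero _ _ _

/-- All `2 q ^ k - 1` pairs with a zero vector satisfy `v ⬝ u = 0` and contribute `1` each; for the
value `-1` there are no such pairs. -/
lemma partSum_one_eq (hk : 0 < k) (hkD : k < D) (hN : D < N - D) (a : Fin D → F)
    (b : Fin (N - D) → F) : (qr F - 1) * partSum x y 1 a b + 2 * qr F ^ k - 1 =
      ∑ u : Fin k → F, ∑ v : Fin k → F,
        if v ⬝ᵥ u = 0 then chi F (((a ᵥ* f.G) ⬝ᵥ u) * (v ⬝ᵥ f.H *ᵥ b)) else 0 := by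
  classical
  have h1 := sum_pairs_eq fun u v : Fin k → F =>
    if v ⬝ᵥ u = 0 then chi F (((a ᵥ* f.G) ⬝ᵥ u) * (v ⬝ᵥ f.H *ᵥ b)) else 0
  simp only [zero_dotProduct, dotProduct_zero, if_true, Finset.sum_const, zero_mul, mul_zero,
    AddChar.map_zero_eq_one, Finset.card_univ, Fintype.card_fun, Fintype.card_fin] at h1
  have h3 : (qr F - 1) * partSum x y 1 a b = ∑ p ∈ pairs (Fin k) (Fin k) F,
      if p.2 ⬝ᵥ p.1 = 0 then chi F (((a ᵥ* f.G) ⬝ᵥ p.1) * (p.2 ⬝ᵥ f.H *ᵥ b)) else 0 := by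
    rw [partSum_mul f hk hkD hN]
    have h2 := sum_pairs_isCol_isRow f fun (u : Fin D → F) (v : Fin (N - D) → F) =>
      if (v ᵥ* f.R) ⬝ᵥ (f.L *ᵥ u) = 0 then chi F ((a ⬝ᵥ u) * (v ⬝ᵥ b)) else 0
    simp only [f.L_G, f.H_R] at h2
    simp only [← dotProduct_mulVec a f.G, dotProduct_mulVec _ f.H b]
    rw [← h2]
    refine Finset.sum_congr rfl fun p _ => ?_
    exact f.ite_kind_one _ _ _
  rw [h3, h1]
  simp [qr]
  ring

lemma dotProduct_factor (a : Fin D → F) (b : Fin (N - D) → F) :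
    (a ᵥ* f.G) ⬝ᵥ (f.H *ᵥ b) = a ⬝ᵥ (x - y) *ᵥ b := by
  rw [← dotProduct_mulVec, mulVec_mulVec, f.mul_eq]

lemma qr_mul_partSum_zero (hk : 0 < k) (hkD : k < D) (hN : D < N - D) (a : Fin D → F)
    (b : Fin (N - D) → F) : (qr F : ℂ) * ((qr F - 1) * partSum x y 0 a b) =
      (qr F : ℂ) ^ k * ((qr F - 1) * chi F (-(a ⬝ᵥ (x - y) *ᵥ b)) +
        degenerateCard (a ᵥ* f.G) (f.H *ᵥ b) - 1 -
        (qr F - 1) * if a ⬝ᵥ (x - y) *ᵥ b = 0 then 1 else 0) := by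
  rw [partSum_zero_eq f hk hkD hN, sum_dotProduct_eq, dotProduct_factor]
  simp

lemma qr_mul_partSum_one (hk : 0 < k) (hkD : k < D) (hN : D < N - D) (a : Fin D → F)
    (b : Fin (N - D) → F) :
    (qr F : ℂ) * ((qr F - 1) * partSum x y 1 a b + 2 * qr F ^ k - 1) =
      (qr F : ℂ) ^ k * (qr F + (qr F - 1) +
        degenerateCard (a ᵥ* f.G) (f.H *ᵥ b) - 1 -
        (qr F - 1) * if a ⬝ᵥ (x - y) *ᵥ b = 0 then 1 else 0) := by
  rw [partSum_one_eq f hk hkD hN, sum_dotProduct_eq, dotProduct_factor]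
  simp

end PartSum

end Sums

/-! ### Linear independence of the six character sums. -/

section Independence

variable {F : Type*} [Field F] [Fintype F] [DecidableEq F]

lemma chi_ne_zero (t : F) : chi F t ≠ 0 := fun h => by
  have := chi_mul_conj t
  rw [h, zero_mul] at this
  exact zero_ne_one this

/-- If `χ` were constant off `0`, a scalar `s ∉ {0, -1}` would give `χ(s) χ(1) = χ(s + 1) = χ(1)`,
hence `χ = 1`. For `q = 2` there is no such `s`, and `O₃` is empty. -/
lemma exists_chi_neg_ne (hq : Fintype.card F ≠ 2) :
    ∃ s t : F, s ≠ 0 ∧ t ≠ 0 ∧ chi F (-s) ≠ chi F (-t) := by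
  by_contra! h
  have h' : ∀ s t : F, s ≠ 0 → t ≠ 0 → chi F s = chi F t := fun s t hs ht => by
    simpa using h (-s) (-t) (neg_ne_zero.mpr hs) (neg_ne_zero.mpr ht)
  obtain ⟨s, -, hs⟩ : ∃ s ∈ (Finset.univ : Finset F), s ∉ ({0, -1} : Finset F) := by
    apply Finset.exists_mem_notMem_of_card_lt_card
    have h1 : 1 < Fintype.card F := Fintype.one_lt_card
    have h2 : ({0, -1} : Finset F).card ≤ 2 := Finset.card_le_two
    rw [Finset.card_univ]
    omega
  simp only [Finset.mem_insert, Finset.mem_singleton, not_or] at hs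
  have h1 : chi F (s + 1) = chi F 1 :=
    h' _ _ (fun h0 => hs.2 (eq_neg_of_add_eq_zero_left h0)) one_ne_zero
  rw [AddChar.map_add_eq_mul, h' s 1 hs.1 one_ne_zero] at h1
  have h3 : chi F 1 = 1 := mul_left_cancel₀ (chi_ne_zero _) (by rw [h1, mul_one])
  obtain ⟨t, ht⟩ := exists_chi_ne_one (one_ne_zero (α := F))
  rw [mul_one] at ht
  rcases eq_or_ne t 0 with rfl | h0
  · simp at ht
  · exact ht (by rw [h' t 1 h0 one_ne_zero, h3])

/-- Two coordinates are needed so that `s = 0` is attained by nonzero vectors. -/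
lemma exists_dotProduct_eq {k : ℕ} (hk : 2 ≤ k) (s : F) :
    ∃ a b : Fin k → F, a ≠ 0 ∧ b ≠ 0 ∧ a ⬝ᵥ b = s := by
  let i : Fin k := ⟨0, by omega⟩
  let j : Fin k := ⟨1, by omega⟩
  have hij : i ≠ j := by simp [i, j, Fin.ext_iff]
  refine ⟨Pi.single i s + Pi.single j 1, Pi.single i 1, fun h => ?_, fun h => ?_, ?_⟩
  · have := congrFun h j
    simp [hij.symm] at this
  · have := congrFun h i
    simp at this
  · simp [hij]

namespace RankFactorization

variable {m n : Type*} [Fintype m] [Fintype n] {B : Matrix m n F} {k : ℕ}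
  (f : RankFactorization B k)

lemma exists_vecMul_G_eq (w : Fin k → F) (hw : w ≠ 0) : ∃ a, a ≠ 0 ∧ a ᵥ* f.G = w := by
  have h : (w ᵥ* f.L) ᵥ* f.G = w := by rw [vecMul_vecMul, f.left_inv, vecMul_one]
  refine ⟨w ᵥ* f.L, fun h0 => hw ?_, h⟩
  rw [← h, h0, zero_vecMul]

lemma exists_mulVec_H_eq (w : Fin k → F) (hw : w ≠ 0) : ∃ b, b ≠ 0 ∧ f.H *ᵥ b = w := by
  obtain ⟨b, hb, h⟩ := f.transpose.exists_vecMul_G_eq w hw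
  exact ⟨b, hb, by rwa [transpose, vecMul_transpose] at h⟩

lemma exists_mulVec_H_eq_zero (h : k < Fintype.card n) : ∃ b, b ≠ 0 ∧ f.H *ᵥ b = 0 := by
  have h1 : LinearMap.ker f.H.mulVecLin ≠ ⊥ := LinearMap.ker_ne_bot_of_finrank_lt (by simpa using h)
  obtain ⟨b, hb, hb0⟩ := (Submodule.ne_bot_iff _).mp h1
  exact ⟨b, hb0, hb⟩

lemma exists_vecMul_G_eq_zero (h : k < Fintype.card m) : ∃ a, a ≠ 0 ∧ a ᵥ* f.G = 0 := by
  obtain ⟨a, ha, h⟩ := f.transpose.exists_mulVec_H_eq_zero h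
  exact ⟨a, ha, by rwa [transpose, mulVec_transpose] at h⟩

end RankFactorization

variable {D N : ℕ} {x y : Vertex F D N} {k : ℕ} (f : RankFactorization (x - y) k)

/-- Inclusion-exclusion: `O₁`, `O₂` and the four product unions replace the six parts as a basis, so
that every sum has a closed form. -/
lemma sum_mul_partSum (hk : 0 < k) (hkD : k < D) (hN : D < N - D) (a : Fin D → F)
    (b : Fin (N - D) → F) (c : Fin 6 → ℝ) :
    ∑ i, (c i : ℂ) * partSum x y i a b =
      (c 0 - c 2) * partSum x y 0 a b + (c 1 - c 2) * partSum x y 1 a b +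
      (c 2 - c 3 - c 4 + c 5) * theta F (Fin k) (Fin k) (vecMulVec (a ᵥ* f.G) (f.H *ᵥ b)).rank +
      (c 3 - c 5) * theta F (Fin k) (Fin (N - D)) (vecMulVec (a ᵥ* f.G) b).rank +
      (c 4 - c 5) * theta F (Fin D) (Fin k) (vecMulVec a (f.H *ᵥ b)).rank +
      c 5 * theta F (Fin D) (Fin (N - D)) (vecMulVec a b).rank := by
  rw [← partSum_mem f hk hkD hN, ← partSum_isCol f hk hkD hN, ← partSum_isRow f hk hkD hN,
    ← sum_partSum f hk hkD hN, Fin.sum_univ_six, Fin.sum_univ_six]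
  ring

lemma theta_one_pos (hD : 2 ≤ D) (hN : D < N - D) : 0 < theta F (Fin D) (Fin (N - D)) 1 := by
  have hq := one_lt_qr F
  have hq2 : 2 ≤ qr F := by
    have : 1 < Fintype.card F := Fintype.one_lt_card
    unfold qr
    exact_mod_cast this
  unfold theta
  rw [Fintype.card_fin, Fintype.card_fin]
  refine div_pos ?_ (by linarith)
  have h1 : qr F ^ (D + (N - D - 1)) = qr F ^ (D - 1) * qr F ^ (N - D) := by
    rw [← pow_add]; congr 1; omega
  have h2 : 2 ≤ qr F ^ (D - 1) := hq2.trans (le_self_pow₀ hq.le (by omega))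
  have h3 : qr F ^ D ≤ qr F ^ (N - D) := pow_le_pow_right₀ hq.le hN.le
  have h4 : 0 < qr F ^ (N - D) := by positivity
  rw [h1]
  nlinarith

lemma theta_zero_sub_one_ne_zero {m n : Type*} [Fintype m] [Fintype n] (hn : 0 < Fintype.card n) :
    (theta F m n 0 : ℂ) - theta F m n 1 ≠ 0 := by
  have := theta_lt (F := F) (m := m) (n := n) one_pos hn
  exact_mod_cast sub_ne_zero.mpr this.ne'

lemma eq_zero_of_sum_mul_partSum (hq : Fintype.card F ≠ 2) (f : RankFactorization (x - y) k)
    (hk : 2 ≤ k) (hkD : k < D)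
    (hN : D < N - D) (c : Fin 6 → ℝ)
    (h : ∀ a b, a ≠ 0 → b ≠ 0 → ∑ i, (c i : ℂ) * partSum x y i a b = 0) : c = 0 := by
  have hk0 : 0 < k := by omega
  have hqr : (qr F : ℂ) ≠ 0 := by exact_mod_cast (one_pos.trans (one_lt_qr F)).ne'
  have hqr1 := qr_sub_one_ne_zero (F := F)
  -- When `aᵀG` and `Hb` are both nonzero, all ranks and degenerate counts are fixed; `Z` collects
  -- everything independent of `s = aᵀBb`.
  obtain ⟨Z, hZ⟩ : ∃ Z : ℂ, ∀ s : F, (c 0 - c 2) * ((qr F : ℂ) ^ k * ((qr F - 1) *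
      (chi F (-s) - if s = 0 then 1 else 0))) -
      (c 1 - c 2) * ((qr F : ℂ) ^ k * ((qr F - 1) * if s = 0 then 1 else 0)) + Z = 0 := by
    refine ⟨(c 0 - c 2) * ((qr F : ℂ) ^ k * ((Fintype.card F : ℝ) ^ (k - 1) - 1)) +
      (c 1 - c 2) * ((qr F : ℂ) ^ k * (qr F + (qr F - 1) + (Fintype.card F : ℝ) ^ (k - 1) - 1) -
        qr F * (2 * qr F ^ k - 1)) + qr F * (qr F - 1) *
      ((c 2 - c 3 - c 4 + c 5) * theta F (Fin k) (Fin k) 1 +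
      (c 3 - c 5) * theta F (Fin k) (Fin (N - D)) 1 +
      (c 4 - c 5) * theta F (Fin D) (Fin k) 1 +
      c 5 * theta F (Fin D) (Fin (N - D)) 1), fun s => ?_⟩
    obtain ⟨a', b', ha', hb', hs⟩ := exists_dotProduct_eq hk s
    obtain ⟨a, ha, haG⟩ := f.exists_vecMul_G_eq a' ha'
    obtain ⟨b, hb, hbH⟩ := f.exists_mulVec_H_eq b' hb'
    have h0 := h a b ha hb
    have h1 := qr_mul_partSum_zero f hk0 hkD hN a b
    have h2 := qr_mul_partSum_one f hk0 hkD hN a b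
    rw [sum_mul_partSum f hk0 hkD hN, haG, hbH, rank_vecMulVec_eq_one ha' hb',
      rank_vecMulVec_eq_one ha' hb, rank_vecMulVec_eq_one ha hb', rank_vecMulVec_eq_one ha hb]
      at h0
    rw [← dotProduct_factor f, haG, hbH, hs, degenerateCard_of_ne_zero ha' hb',
      Fintype.card_fin] at h1 h2
    push_cast at h1 h2 ⊢
    linear_combination (qr F * (qr F - 1) : ℂ) * h0 - (c 0 - c 2 : ℂ) * h1 - (c 1 - c 2 : ℂ) * h2
  have e02 : (c 0 : ℂ) - c 2 = 0 := by
    obtain ⟨s, t, hs, ht, hst⟩ := exists_chi_neg_ne hq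
    have h1 := hZ s
    have h2 := hZ t
    rw [if_neg hs] at h1
    rw [if_neg ht] at h2
    have h3 : ((c 0 : ℂ) - c 2) * ((qr F : ℂ) ^ k * (qr F - 1) * (chi F (-s) - chi F (-t))) = 0 := by
      linear_combination h1 - h2
    exact (mul_eq_zero.mp h3).resolve_right
      (mul_ne_zero (mul_ne_zero (pow_ne_zero _ hqr) hqr1) (sub_ne_zero.mpr hst))
  have e12 : (c 1 : ℂ) - c 2 = 0 := by
    have h1 := hZ 0
    have h2 := hZ 1
    rw [if_pos rfl, e02] at h1
    rw [if_neg one_ne_zero, e02] at h2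
    have h3 : ((c 1 : ℂ) - c 2) * ((qr F : ℂ) ^ k * (qr F - 1)) = 0 := by
      linear_combination h2 - h1
    exact (mul_eq_zero.mp h3).resolve_right (mul_ne_zero (pow_ne_zero _ hqr) hqr1)
  have h' : ∀ a b, a ≠ 0 → b ≠ 0 →
      ((c 2 : ℂ) - c 3 - c 4 + c 5) *
        theta F (Fin k) (Fin k) (vecMulVec (a ᵥ* f.G) (f.H *ᵥ b)).rank +
      (c 3 - c 5) * theta F (Fin k) (Fin (N - D)) (vecMulVec (a ᵥ* f.G) b).rank +
      (c 4 - c 5) * theta F (Fin D) (Fin k) (vecMulVec a (f.H *ᵥ b)).rank +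
      c 5 * theta F (Fin D) (Fin (N - D)) 1 = 0 := by
    intro a b ha hb
    have := h a b ha hb
    rw [sum_mul_partSum f hk0 hkD hN, rank_vecMulVec_eq_one ha hb, e02, e12] at this
    linear_combination this
  obtain ⟨w, hw⟩ : ∃ w : Fin k → F, w ≠ 0 := by
    obtain ⟨w, -, hw, -⟩ := exists_dotProduct_eq (F := F) hk 0
    exact ⟨w, hw⟩
  -- The remaining sums depend only on whether `aᵀG` and `Hb` vanish. Comparing the four cases
  -- isolates one coefficient at a time, as `theta` differs at ranks `0` and `1`; the both-zero case
  -- then gives `c 5 = 0`.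
  obtain ⟨a₀, ha₀, haG₀⟩ := f.exists_vecMul_G_eq_zero (by simpa using hkD)
  obtain ⟨b₀, hb₀, hbH₀⟩ := f.exists_mulVec_H_eq_zero (by simpa using hkD.trans hN)
  obtain ⟨a₁, ha₁, haG₁⟩ := f.exists_vecMul_G_eq w hw
  obtain ⟨b₁, hb₁, hbH₁⟩ := f.exists_mulVec_H_eq w hw
  have h00 := h' a₀ b₀ ha₀ hb₀
  have h01 := h' a₀ b₁ ha₀ hb₁
  have h10 := h' a₁ b₀ ha₁ hb₀
  have h11 := h' a₁ b₁ ha₁ hb₁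
  have z1 : ∀ {p q : ℕ} (v : Fin q → F), (vecMulVec (0 : Fin p → F) v).rank = 0 := fun v =>
    rank_eq_zero_iff.mpr (vecMulVec_eq_zero_iff.mpr (Or.inl rfl))
  have z2 : ∀ {p q : ℕ} (u : Fin p → F), (vecMulVec u (0 : Fin q → F)).rank = 0 := fun u =>
    rank_eq_zero_iff.mpr (vecMulVec_eq_zero_iff.mpr (Or.inr rfl))
  rw [haG₀, hbH₀, z1, z1, z2] at h00
  rw [haG₀, hbH₁, z1, z1, rank_vecMulVec_eq_one ha₀ hw] at h01
  rw [haG₁, hbH₀, z2, rank_vecMulVec_eq_one hw hb₀, z2] at h10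
  rw [haG₁, hbH₁, rank_vecMulVec_eq_one hw hw, rank_vecMulVec_eq_one hw hb₁,
    rank_vecMulVec_eq_one ha₁ hw] at h11
  have t1 := theta_zero_sub_one_ne_zero (F := F) (m := Fin D) (n := Fin k) (by simpa using hk0)
  have t2 := theta_zero_sub_one_ne_zero (F := F) (m := Fin k) (n := Fin (N - D))
    (by rw [Fintype.card_fin]; omega)
  have t3 := theta_zero_sub_one_ne_zero (F := F) (m := Fin k) (n := Fin k) (by simpa using hk0)
  have t4 : (theta F (Fin D) (Fin (N - D)) 1 : ℂ) ≠ 0 := by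
    exact_mod_cast (theta_one_pos (by omega) hN).ne'
  have e45 : (c 4 : ℂ) - c 5 = 0 := by
    refine (mul_eq_zero.mp ?_).resolve_right t1
    linear_combination h00 - h01
  have e35 : (c 3 : ℂ) - c 5 = 0 := by
    refine (mul_eq_zero.mp ?_).resolve_right t2
    linear_combination h00 - h10
  have e25 : (c 2 : ℂ) - c 5 = 0 := by
    have : ((c 2 : ℂ) - c 3 - c 4 + c 5) = 0 := by
      refine (mul_eq_zero.mp ?_).resolve_right t3
      rw [e45, e35] at h00 h11
      linear_combination h00 - h11
    linear_combination this + e35 + e45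
  have e5 : (c 5 : ℂ) = 0 := by
    refine (mul_eq_zero.mp ?_).resolve_right t4
    rw [e45, e35, show (c 2 : ℂ) - c 3 - c 4 + c 5 = 0 by
      linear_combination e25 - e35 - e45] at h00
    linear_combination h00
  have e2 : (c 2 : ℂ) = 0 := by linear_combination e25 + e5
  ext i
  have key : (c i : ℂ) = 0 := by
    fin_cases i
    · change (c 0 : ℂ) = 0; linear_combination e02 + e2
    · change (c 1 : ℂ) = 0; linear_combination e12 + e2
    · exact e2
    · change (c 3 : ℂ) = 0; linear_combination e35 + e5
    · change (c 4 : ℂ) = 0; linear_combination e45 + e5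
    · exact e5
  exact_mod_cast key

end Independence

/-! ### Membership, orthogonality and dimensions. -/

section Main

variable {F : Type*} [Field F] [Fintype F] [DecidableEq F] {D N : ℕ}

lemma fourier_add (v w : EuclideanSpace ℝ (Vertex F D N)) (a : Fin D → F) (b : Fin (N - D) → F) :
    fourier (v + w) a b = fourier v a b + fourier w a b := by
  simp [fourier, add_mul, Finset.sum_add_distrib]

lemma fourier_smul (c : ℝ) (v : EuclideanSpace ℝ (Vertex F D N)) (a : Fin D → F)
    (b : Fin (N - D) → F) : fourier (c • v) a b = c * fourier v a b := by
  simp [fourier, Finset.mul_sum, mul_assoc]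

lemma fourier_sub (v w : EuclideanSpace ℝ (Vertex F D N)) (a : Fin D → F) (b : Fin (N - D) → F) :
    fourier (v - w) a b = fourier v a b - fourier w a b := by
  simp [fourier, sub_mul, Finset.sum_sub_distrib]

lemma fourier_sum {ι : Type*} (s : Finset ι) (v : ι → EuclideanSpace ℝ (Vertex F D N))
    (a : Fin D → F) (b : Fin (N - D) → F) :
    fourier (∑ i ∈ s, v i) a b = ∑ i ∈ s, fourier (v i) a b := by
  classical
  induction s using Finset.induction_on with
  | empty => simp [fourier]
  | insert i s hi ih => rw [Finset.sum_insert hi, Finset.sum_insert hi, fourier_add, ih]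

lemma fourier_single (z : Vertex F D N) (a : Fin D → F) (b : Fin (N - D) → F) :
    fourier (EuclideanSpace.single z 1) a b = chi F (a ⬝ᵥ z *ᵥ b) := by
  rw [fourier, Finset.sum_eq_single z]
  · simp
  · intro w _ hw
    simp [hw]
  · simp

lemma fourier_charVec_part (x y : Vertex F D N) (i : Fin 6) (a : Fin D → F)
    (b : Fin (N - D) → F) :
    fourier (charVec (part x y i)) a b = chi F (a ⬝ᵥ x *ᵥ b) * partSum x y i a b := by
  rw [charVec, fourier_sum, partSum, Finset.mul_sum]
  refine Finset.sum_congr rfl fun z _ => ?_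
  rw [fourier_single, ← AddChar.map_add_eq_mul, ← dotProduct_add, ← add_mulVec]
  congr 3
  abel

lemma linearIndependent_idemMap_part (hq : Fintype.card F ≠ 2) {x y : Vertex F D N} {k : ℕ}
    (f : RankFactorization (x - y) k) (hk : 2 ≤ k) (hkD : k < D) (hN : D < N - D) :
    LinearIndependent ℝ fun i : Fin 6 => idemMap F D N (charVec (part x y i)) := by
  rw [Fintype.linearIndependent_iff]
  intro c hc
  simp only [← map_smul, ← map_sum] at hc
  rw [idemMap_eq_zero_iff (by omega) (by omega)] at hc
  have := eq_zero_of_sum_mul_partSum hq f hk hkD hN c fun a b ha hb => by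
    have h := hc a b ha hb
    rw [fourier_sum] at h
    simp only [fourier_smul, fourier_charVec_part, mul_left_comm _ (chi F _)] at h
    rw [← Finset.mul_sum] at h
    exact (mul_eq_zero.mp h).resolve_left (chi_ne_zero _)
  exact fun i => congrFun this i

/-- The parts add up to the neighbourhood of `x`, and `E` maps its characteristic vector to `θ₁ E
x̂` with `θ₁ ≠ 0`. -/
lemma idemMap_single_mem_S {x y : Vertex F D N} {k : ℕ}
    (f : RankFactorization (x - y) k) (hk : 2 ≤ k) (hkD : k < D) (hN : D < N - D) :
    idemMap F D N (EuclideanSpace.single x 1) ∈ S x y := by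
  have h0 : theta F (Fin D) (Fin (N - D)) 1 ≠ 0 := (theta_one_pos (by omega) hN).ne'
  have h : idemMap F D N (∑ i, charVec (part x y i) -
      theta F (Fin D) (Fin (N - D)) 1 • EuclideanSpace.single x 1) = 0 := by
    rw [idemMap_eq_zero_iff (by omega) (by omega)]
    intro a b ha hb
    rw [fourier_sub, fourier_smul, fourier_sum, fourier_single]
    simp only [fourier_charVec_part]
    rw [← Finset.mul_sum, sum_partSum f (by omega) hkD hN, rank_vecMulVec_eq_one ha hb]
    ring
  rw [map_sub, map_sum, map_smul, sub_eq_zero] at h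
  rw [← inv_smul_smul₀ h0 (idemMap F D N (EuclideanSpace.single x 1)), ← h]
  exact Submodule.smul_mem _ _ (Submodule.sum_mem _ fun i _ => Submodule.subset_span ⟨i, rfl⟩)

/-- In the difference of the sums over `O₁` and `O₂` the degenerate count and the indicator of `s =
0` cancel. What is left is a constant, giving `x̂`, and `χ(-s)`, which is the character at `y`
relative to `x`. -/
lemma idemMap_single_mem_S_right {x y : Vertex F D N} {k : ℕ}
    (f : RankFactorization (x - y) k) (hk : 2 ≤ k) (hkD : k < D) (hN : D < N - D) :
    idemMap F D N (EuclideanSpace.single y 1) ∈ S x y := by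
  have hqr : qr F ≠ 0 := (one_pos.trans (one_lt_qr F)).ne'
  have hqr1 : qr F - 1 ≠ 0 := sub_ne_zero.mpr (one_lt_qr F).ne'
  set A : ℝ := qr F * (2 * qr F ^ k - 1) - qr F ^ k * (qr F + (qr F - 1)) with hA
  have h : idemMap F D N ((qr F * (qr F - 1)) • (charVec (part x y 0) - charVec (part x y 1)) -
      A • EuclideanSpace.single x 1 -
      (qr F ^ k * (qr F - 1)) • EuclideanSpace.single y 1) = 0 := by
    rw [idemMap_eq_zero_iff (by omega) (by omega)]
    intro a b ha hb
    have h1 := qr_mul_partSum_zero f (by omega) hkD hN a b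
    have h2 := qr_mul_partSum_one f (by omega) hkD hN a b
    have h3 : chi F (a ⬝ᵥ y *ᵥ b) = chi F (a ⬝ᵥ x *ᵥ b) * chi F (-(a ⬝ᵥ (x - y) *ᵥ b)) := by
      rw [← AddChar.map_add_eq_mul, sub_mulVec, dotProduct_sub]
      congr 1
      ring
    simp only [fourier_sub, fourier_smul, fourier_single, fourier_charVec_part]
    rw [h3, hA]
    push_cast
    linear_combination chi F (a ⬝ᵥ x *ᵥ b) * (h1 - h2)
  have hne : qr F ^ k * (qr F - 1) ≠ 0 := mul_ne_zero (pow_ne_zero _ hqr) hqr1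
  rw [map_sub, map_smul _ (qr F ^ k * (qr F - 1)), sub_eq_zero] at h
  rw [← inv_smul_smul₀ hne (idemMap F D N (EuclideanSpace.single y 1)), ← h, map_sub, map_smul,
    map_smul, map_sub]
  refine Submodule.smul_mem _ _ (Submodule.sub_mem _ (Submodule.smul_mem _ _
    (Submodule.sub_mem _ ?_ ?_)) (Submodule.smul_mem _ _ (idemMap_single_mem_S f hk hkD hN)))
  · exact Submodule.subset_span ⟨0, rfl⟩
  · exact Submodule.subset_span ⟨1, rfl⟩

lemma inner_single_idemMap_single (z w : Vertex F D N) :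
    inner ℝ (EuclideanSpace.single z (1 : ℝ)) (idemMap F D N (EuclideanSpace.single w 1)) =
      idem F D N z w := by
  rw [EuclideanSpace.inner_single_left, map_one, one_mul]
  change (idem F D N *ᵥ Pi.single w 1) z = _
  rw [Matrix.mulVec_single_one]
  rfl

lemma inner_idemMap_single (z w : Vertex F D N) (hD : 0 < D) (hN : D < N) :
    inner ℝ (idemMap F D N (EuclideanSpace.single z 1))
      (idemMap F D N (EuclideanSpace.single w 1)) = (Fintype.card (Vertex F D N) : ℝ)⁻¹ *
      theta F (Fin D) (Fin (N - D)) (z - w).rank := by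
  rw [idemMap_inner, inner_single_idemMap_single, idem_apply hD hN]

lemma theta_zero_sub_rank_ne_zero {x y : Vertex F D N} (hk : 0 < (x - y).rank) : theta F (Fin D) (Fin (N - D)) 0 -
      theta F (Fin D) (Fin (N - D)) (x - y).rank ≠ 0 :=
  sub_ne_zero.mpr (theta_lt hk (by simpa using rank_le_sub (x - y))).ne'

/-- `λᵢ` is precisely the ratio of `⟨E Ôᵢ, E x̂ - E ŷ⟩` to `⟨E x̂, E x̂ - E ŷ⟩`, the latter being a
nonzero multiple of `θ*₀ - θ*_k`. -/
lemma inner_idemMap_checkVec (hD : 0 < D) (hN : D < N) {x y : Vertex F D N}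
    (hk : 0 < (x - y).rank) (i : Fin 6) :
    inner ℝ (idemMap F D N (checkVec x y i)) (idemMap F D N (EuclideanSpace.single x 1) -
      idemMap F D N (EuclideanSpace.single y 1)) = 0 := by
  have hxx : dualEigenvalue (graph F D N) (idem F D N) 0 = theta F (Fin D) (Fin (N - D)) 0 := by
    have := dualEigenvalue_dist hD hN x x
    rwa [SimpleGraph.dist_self, sub_self, Matrix.rank_zero] at this
  have hcard : ((part x y i).card : ℝ) * (dualEigenvalue (graph F D N) (idem F D N) 1 -
      dualEigenvalue (graph F D N) (idem F D N) (partDist x y i)) =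
      ∑ z ∈ part x y i, (theta F (Fin D) (Fin (N - D)) (z - x).rank -
        theta F (Fin D) (Fin (N - D)) (z - y).rank) := by
    rw [← nsmul_eq_mul, ← Finset.sum_const]
    refine Finset.sum_congr rfl fun z hz => ?_
    rw [← dualEigenvalue_dist hD hN, ← dualEigenvalue_dist hD hN, graph_dist, graph_dist,
      mem_sphere.mp (part_subset x y i hz), mem_sphere.mp (part_subset_sphere x y i hz)]
  rw [checkVec, charVec, map_sub, map_sum, map_smul, inner_sub_left, sum_inner, inner_smul_left]
  simp only [inner_sub_right, inner_idemMap_single _ _ hD hN, ← mul_sub, sub_self,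
    Matrix.rank_zero, ← Finset.mul_sum]
  rw [← hcard, lam, hxx, dualEigenvalue_dist hD hN]
  have := theta_zero_sub_rank_ne_zero hk
  simp only [conj_trivial]
  field_simp
  ring

lemma symPart_isOrtho_asymPart (hD : 0 < D) (hN : D < N) {x y : Vertex F D N}
    (hk : 0 < (x - y).rank) : symPart x y ⟂ asymPart x y := by
  rw [symPart, asymPart, Submodule.isOrtho_span]
  rintro _ ⟨i, rfl⟩ _ rfl
  exact inner_idemMap_checkVec hD hN hk i

lemma finrank_asymPart (hD : 0 < D) (hN : D < N) {x y : Vertex F D N}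
    (hk : 0 < (x - y).rank) : Module.finrank ℝ (asymPart x y) = 1 := by
  refine finrank_span_singleton fun h => ?_
  have h1 := congrArg (inner ℝ (idemMap F D N (EuclideanSpace.single x 1))) h
  rw [inner_zero_right, inner_sub_right, inner_idemMap_single _ _ hD hN,
    inner_idemMap_single _ _ hD hN, ← mul_sub, sub_self, Matrix.rank_zero] at h1
  exact (mul_eq_zero.mp h1).elim (by simp) (theta_zero_sub_rank_ne_zero hk)

lemma idemMap_checkVec (x y : Vertex F D N) (i : Fin 6) :
    idemMap F D N (checkVec x y i) = idemMap F D N (charVec (part x y i)) -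
      lam x y i • idemMap F D N (EuclideanSpace.single x 1) := by
  rw [checkVec, map_sub, map_smul]

/-- This gives the lower bound `dim Sym(S) ≥ dim S - 1`. -/
lemma S_le_sup (x y : Vertex F D N) :
    S x y ≤ symPart x y ⊔ Submodule.span ℝ {idemMap F D N (EuclideanSpace.single x 1)} := by
  rw [S, Submodule.span_le]
  rintro _ ⟨i, rfl⟩
  have h : idemMap F D N (charVec (part x y i)) = idemMap F D N (checkVec x y i) +
      lam x y i • idemMap F D N (EuclideanSpace.single x 1) := by
    rw [idemMap_checkVec, sub_add_cancel]
  simp only [h]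
  exact Submodule.add_mem_sup (Submodule.subset_span ⟨i, rfl⟩)
    (Submodule.smul_mem _ _ (Submodule.mem_span_singleton_self _))

end Main

end BilinearForms

theorem proposition10p10 (F : Type*) [Field F] [Fintype F] [DecidableEq F]
    (hq : Fintype.card F ≠ 2) (D N : ℕ) (hD : 6 ≤ 2 * D) (hN : 2 * D < N)
    (x y : Matrix (Fin D) (Fin (N - D)) F)
    (hk : 2 ≤ (BilinearForms.graph F D N).dist x y)
    (hk' : (BilinearForms.graph F D N).dist x y ≤ D - 1) :
    BilinearForms.S x y = BilinearForms.symPart x y ⊔ BilinearForms.asymPart x y ∧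
      BilinearForms.symPart x y ⟂ BilinearForms.asymPart x y ∧
      Disjoint (BilinearForms.symPart x y) (BilinearForms.asymPart x y) ∧
      Module.finrank ℝ (BilinearForms.symPart x y) = 5 ∧
      Module.finrank ℝ (BilinearForms.asymPart x y) = 1 := by
  rw [BilinearForms.graph_dist] at hk hk'
  obtain ⟨f⟩ := BilinearForms.nonempty_rankFactorization (x - y)
  have hkD : (x - y).rank < D := by omega
  have hDN : D < N - D := by omega
  have hD0 : 0 < D := by omega
  have hDN' : D < N := by omega
  have hk0 : 0 < (x - y).rank := by omega
  have hx := BilinearForms.idemMap_single_mem_S f hk hkD hDN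
  have hy := BilinearForms.idemMap_single_mem_S_right f hk hkD hDN
  have hortho := BilinearForms.symPart_isOrtho_asymPart hD0 hDN' hk0
  have hS : Module.finrank ℝ (BilinearForms.S x y) = 6 := by
    have := finrank_span_eq_card (BilinearForms.linearIndependent_idemMap_part hq f hk hkD hDN)
    rwa [Fintype.card_fin] at this
  have hasym := BilinearForms.finrank_asymPart hD0 hDN' hk0
  have hle : BilinearForms.symPart x y ⊔ BilinearForms.asymPart x y ≤ BilinearForms.S x y := by
    refine sup_le (Submodule.span_le.mpr ?_) (Submodule.span_le.mpr ?_)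
    · rintro _ ⟨i, rfl⟩
      simp only [BilinearForms.idemMap_checkVec]
      exact Submodule.sub_mem _ (Submodule.subset_span ⟨i, rfl⟩) (Submodule.smul_mem _ _ hx)
    · rintro _ rfl
      exact Submodule.sub_mem _ hx hy
  have hsum := Submodule.finrank_sup_add_finrank_inf_eq
    (BilinearForms.symPart x y) (BilinearForms.asymPart x y)
  rw [hortho.disjoint.eq_bot, finrank_bot, hasym] at hsum
  have h1 := Submodule.finrank_mono hle
  have h2 := (Submodule.finrank_mono (BilinearForms.S_le_sup x y)).trans
    (Submodule.finrank_add_le_finrank_add_finrank _ _)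
  have h3 : Module.finrank ℝ (Submodule.span ℝ
      {BilinearForms.idemMap F D N (EuclideanSpace.single x 1)}) ≤ 1 := by
    simpa using finrank_span_le_card (R := ℝ)
      {BilinearForms.idemMap F D N (EuclideanSpace.single x 1)}
  -- Orthogonality inside `S` gives `dim Sym(S) + 1 ≤ 6`, and the extra line of `E x̂` gives `6 ≤
  -- dim Sym(S) + 1`.
  have hsym : Module.finrank ℝ (BilinearForms.symPart x y) = 5 := by omega
  exact ⟨(Submodule.eq_of_le_of_finrank_eq hle (by omega)).symm, hortho, hortho.disjoint, hsym,
    hasym⟩
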